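/- Let $D=t\partial_t$ and let $\mathcal{SD}$ be the Lie superalgebra of regular differential operators on the super circle $S^{1|1}$ over $\mathbb{C}$, with basis $t^kD^l\partial_\theta\theta,\ t^kD^l\theta\partial_\theta,\ t^kD^l\theta,\ t^kD^l\partial_\theta$ ($k\in\mathbb{Z}$, $l\ge 0$), where $t$ is even and $\theta$ is odd. Identify its elements with sums of terms $t^rF(D)$, where $F=\begin{pmatrix}f_0&f_+\\ f_-&f_1\end{pmatrix}$ stands for $f_0(D)\partial_\theta\theta+f_+(D)\partial_\theta+f_-(D)\theta+f_1(D)\theta\partial_\theta$, $f_a\in\mathbb{C}[w]$. Let ${}^0\mathcal{SD}=\{A\in\mathcal{SD}:\sigma(A)=-A\}$, where $\sigma=\sigma_{-1,1}$ is the anti-involution with $\sigma(t)=-t$, $\sigma(D)=-D-1+\partial_\theta\theta$, $\sigma(\theta)=t\partial_\theta$, $\sigma(\partial_\theta)=-t^{-1}\theta$. Let $\mathfrak g={}^0\widehat{\mathcal{SD}}={}^0\mathcal{SD}\oplus\mathbb{C}C$ be its central extension by the restriction of the super-skew-symmetric two-cocycle $\Psi$ with $\Psi(t^rF(D),t^sG(D))=\sum_{-r\le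 j\le -1}\mathrm{Str}\,(F(j)G(j+r))$ if $r=-s\ge 0$, and $0$ if $r+s\ne 0$. It is $\frac12\mathbb{Z}$-graded by $\mathrm{wt}(t)=1$, $\mathrm{wt}(D)=\mathrm{wt}(C)=0$, $\mathrm{wt}(\theta)=\frac12$, $\mathrm{wt}(\partial_\theta)=-\frac12$, and $\mathfrak g_0$ is abelian. For $\xi\in\mathfrak g_0^*$ let $L(\mathfrak g,\xi)=\bigoplus_{j\in\frac12\mathbb{Z}}L_j$ be the irreducible graded highest weight $\mathfrak g$-module of highest weight $\xi$: it has a nonzero vector $v_\xi\in L_0$ that is annihilated by $\mathfrak g_j$ for all $j>0$, and on which $h\in\mathfrak g_0$ acts as $\xi(h)$. Put $c=\xi(C)$ and define the formal power series $${}^0\Delta_0(x)=-\xi\big(\partial_\theta\theta\,\sinh(xD)\big),\qquad {}^0\Delta_1(x)=-\xi\big(\theta\partial_\theta\,\sinh(x(D+\tfrac12))\big),$$ where $\xi$ is applied coefficientwise in $x$. Theorem. The module $L(\mathfrak g,\xi)$ is quasifinite (that is, $\dim L_j<\infty$ for all $j$) if and only if there is a nonzero polynomial $\alpha\in\mathbb{C}[w]$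 such that $$\alpha\!\left(\frac{d}{dx}\right)\left({}^0\Delta_0(x)+{}^0\Delta_1(x)\,e^{x/2}-\frac{c}{2}\right)=0 .$$ -/

import Mathlib

open Polynomial

noncomputable section

namespace SuperCircle

/-- The associative superalgebra of differential operators on the super circle `S^{1|1}`,
in normal form: the finitely supported family `r ↦ F_r` stands for the operator
`∑ r, t ^ r * F_r(D)` with `D = t ∂_t`. A `2 × 2` matrix has its four entries at the matrix units
`M_{00} = ∂_θ θ`, `M_{11} = θ ∂_θ`, `M_{01} = ∂_θ`, `M_{10} = θ`. (The product is `SD.mul`, not the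
pointwise one.) -/
abbrev SD : Type := ℤ →₀ Matrix (Fin 2) (Fin 2) ℂ[X]

namespace SD

/-- `F(D) ↦ F(D + s)`, entrywise. -/
def shift (s : ℂ) : Matrix (Fin 2) (Fin 2) ℂ[X] →ₐ[ℂ] Matrix (Fin 2) (Fin 2) ℂ[X] :=
  (taylorAlgHom s).mapMatrix

/-- The associative product: `t ^ r F(D) * t ^ s G(D) = t ^ (r + s) F(D + s) G(D)`. -/
def mul : SD →ₗ[ℂ] SD →ₗ[ℂ] SD :=
  Finsupp.lsum ℂ fun r : ℤ => LinearMap.flip (Finsupp.lsum ℂ fun s : ℤ =>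
    LinearMap.mk₂ ℂ
      (fun G F : Matrix (Fin 2) (Fin 2) ℂ[X] =>
        (Finsupp.single (r + s) (shift (s : ℂ) F * G) : SD))
      (fun _ _ _ => by rw [mul_add, Finsupp.single_add])
      (fun _ _ _ => by rw [mul_smul_comm, Finsupp.smul_single])
      (fun _ _ _ => by rw [map_add, add_mul, Finsupp.single_add])
      (fun _ _ _ => by rw [map_smul, smul_mul_assoc, Finsupp.smul_single]))

theorem mul_single (r s : ℤ) (F G : Matrix (Fin 2) (Fin 2) ℂ[X]) :
    mul (Finsupp.single r F) (Finsupp.single s G)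
      = Finsupp.single (r + s) (shift (s : ℂ) F * G) := by
  simp [mul]

/-- The component of parity `p` of a supermatrix: even is diagonal, odd is off-diagonal. -/
def matPart (p : Fin 2) : Matrix (Fin 2) (Fin 2) ℂ[X] →ₗ[ℂ] Matrix (Fin 2) (Fin 2) ℂ[X] where
  toFun F := Matrix.of fun i k => if i + k = p then F i k else 0
  map_add' F G := by ext i k : 2; simp only [Matrix.of_apply, Matrix.add_apply]; split_ifs <;> simp
  map_smul' c F := by
    ext i k : 2; simp only [Matrix.of_apply, Matrix.smul_apply, RingHom.id_apply]
    split_ifs <;> simp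

/-- The component of parity `p` of an operator. -/
def part (p : Fin 2) : SD →ₗ[ℂ] SD := Finsupp.mapRange.linearMap (matPart p)

/-- The super-bracket: `[A, B] = A B - (-1) ^ (|A| |B|) B A` on homogeneous elements, extended
bilinearly. -/
def bracket (A B : SD) : SD :=
  mul A B - ∑ p : Fin 2, ∑ q : Fin 2, (-1 : ℂ) ^ (p.val * q.val) • mul (part q B) (part p A)

/-- The supertrace of the complex matrix `F(a) G(b)`. -/
def strEval (F G : Matrix (Fin 2) (Fin 2) ℂ[X]) (a b : ℂ) : ℂ :=
  (F.map (eval a) * G.map (eval b)) 0 0 - (F.map (eval a) * G.map (eval b)) 1 1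

/-- The two-cocycle. On `t ^ r F(D)`, `t ^ s G(D)` it vanishes if `r + s ≠ 0`, it is
`∑_{-r ≤ j ≤ -1} Str (F(j) G(j + r))` if `r = -s ≥ 0`, and for `r = -s < 0` it is the value forced
by super-skew-symmetry, `-∑_{0 ≤ j ≤ -r-1} Str (F(j) G(j + r))`. -/
def cocycle (A B : SD) : ℂ :=
  A.sum fun r F => B.sum fun s G =>
    if r + s ≠ 0 then 0
    else if 0 ≤ r then ∑ j ∈ Finset.Ico (-r) 0, strEval F G (j : ℂ) ((j + r : ℤ) : ℂ)
    else -∑ j ∈ Finset.Ico 0 (-r), strEval F G (j : ℂ) ((j + r : ℤ) : ℂ)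

/-- `f(D) ↦ f(a - D)`. -/
def negShift (a : ℂ) : ℂ[X] →ₐ[ℂ] ℂ[X] := aeval (C a - X)

/-- The image of `t ^ r F(D)` under the anti-involution `σ_{-1,1}`. -/
def sigmaSingle (r : ℤ) : Matrix (Fin 2) (Fin 2) ℂ[X] →ₗ[ℂ] SD where
  toFun F := (-1 : ℂ) ^ r •
    (Finsupp.single r !![negShift (-r) (F 0 0), 0; 0, negShift (-r - 1) (F 1 1)]
      + Finsupp.single (r + 1) !![0, negShift (-r - 1) (F 1 0); 0, 0]
      - Finsupp.single (r - 1) !![0, 0; negShift (-r) (F 0 1), 0])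
  map_add' F G := by
    rw [← smul_add]; congr 1
    have h1 : ∀ a b c d : ℂ[X], !![a + b, 0; 0, c + d] = !![a, 0; 0, c] + !![b, 0; 0, d] := by
      intros; simp
    have h2 : ∀ a b : ℂ[X], !![0, a + b; 0, 0] = !![0, a; 0, 0] + !![0, b; 0, 0] := by
      intros; simp
    have h3 : ∀ a b : ℂ[X], !![0, 0; a + b, 0] = !![0, 0; a, 0] + !![0, 0; b, 0] := by
      intros; simp
    simp only [Matrix.add_apply, map_add, h1, h2, h3, Finsupp.single_add]
    abel
  map_smul' c F := by
    have h1 : ∀ a d : ℂ[X], !![c • a, 0; 0, c • d] = c • !![a, 0; 0, d] := by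
      intros; simp
    have h2 : ∀ a : ℂ[X], !![0, c • a; 0, 0] = c • !![0, a; 0, 0] := by
      intros; simp
    have h3 : ∀ a : ℂ[X], !![0, 0; c • a, 0] = c • !![0, 0; a, 0] := by
      intros; simp
    simp only [Matrix.smul_apply, map_smul, h1, h2, h3, ← Finsupp.smul_single, RingHom.id_apply]
    rw [← smul_add, ← smul_sub, smul_comm]

/-- The anti-involution `σ_{-1,1}`, that is, the linear map with `σ² = 1` and
`σ(A B) = (-1) ^ (|A| |B|) σ(B) σ(A)` for which `σ(t) = -t`, `σ(D) = -D - 1 + ∂_θ θ`,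
`σ(θ) = t ∂_θ`, `σ(∂_θ) = -t⁻¹ θ`. -/
def sigma : SD →ₗ[ℂ] SD := Finsupp.lsum ℂ sigmaSingle

/-- The elementary operator `t ^ r f(D) M_{ik}`. -/
def el (i k : Fin 2) (r : ℤ) (f : ℂ[X]) : SD := Finsupp.single r (Matrix.single i k f)

theorem mul_el (i k l m : Fin 2) (r s : ℤ) (f g : ℂ[X]) :
    mul (el i k r f) (el l m s g) = if k = l then el i m (r + s) (taylor (s : ℂ) f * g) else 0 := by
  have h : shift (s : ℂ) (Matrix.single i k f) = Matrix.single i k (taylor (s : ℂ) f) := by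
    simp [shift]
  rw [el, el, mul_single, h]
  split_ifs with hkl
  · subst hkl; rw [Matrix.single_mul_single_same]; rfl
  · rw [Matrix.single_mul_single_of_ne _ _ _ _ hkl, Finsupp.single_zero]

theorem sigma_el (i k : Fin 2) (r : ℤ) (f : ℂ[X]) :
    sigma (el i k r f) = ((if i = 0 ∧ k = 1 then -1 else 1) * (-1 : ℂ) ^ r) •
      el k i (r + i.val - k.val) (negShift (-r - (i.val : ℂ)) f) := by
  have e1 : ∀ a d : ℂ[X], !![a, 0; 0, d] = Matrix.single 0 0 a + Matrix.single 1 1 d := by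
    intro a d; ext i k : 2
    fin_cases i <;> fin_cases k <;> simp [Matrix.single]
  have e2 : ∀ b : ℂ[X], !![0, b; 0, 0] = Matrix.single 0 1 b := by
    intro b; ext i k : 2
    fin_cases i <;> fin_cases k <;> simp [Matrix.single]
  have e3 : ∀ c : ℂ[X], !![0, 0; c, 0] = Matrix.single 1 0 c := by
    intro c; ext i k : 2
    fin_cases i <;> fin_cases k <;> simp [Matrix.single]
  have h : ∀ a : Fin 2, a = 0 ∨ a = 1 := by decide
  rw [sigma, el, Finsupp.lsum_single, sigmaSingle, LinearMap.coe_mk, AddHom.coe_mk, e1, e2, e3]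
  rcases h i with rfl | rfl <;> rcases h k with rfl | rfl <;> simp [el]

theorem el_add (i k : Fin 2) (r : ℤ) (f g : ℂ[X]) : el i k r (f + g) = el i k r f + el i k r g := by
  simp [el, Matrix.single_add]

theorem part_el (p i k : Fin 2) (r : ℤ) (f : ℂ[X]) :
    part p (el i k r f) = if i + k = p then el i k r f else 0 := by
  have h : matPart p (Matrix.single i k f) = if i + k = p then Matrix.single i k f else 0 := by
    ext a b : 2
    simp only [matPart, LinearMap.coe_mk, AddHom.coe_mk, Matrix.of_apply]
    by_cases hab : i = a ∧ k = b
    · obtain ⟨rfl, rfl⟩ := hab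
      split_ifs <;> simp
    · rw [Matrix.single_apply, if_neg hab, ite_self]
      split_ifs
      · rw [Matrix.single_apply, if_neg hab]
      · rfl
  rw [el, part, Finsupp.mapRange.linearMap_apply, Finsupp.mapRange_single, h]
  split_ifs <;> simp

theorem induction_el {motive : SD → Prop} (h0 : motive 0)
    (hadd : ∀ A B, motive A → motive B → motive (A + B))
    (hel : ∀ i k r f, motive (el i k r f)) (A : SD) : motive A := by
  induction A using Finsupp.induction_linear with
  | zero => exact h0
  | add A B hA hB => exact hadd A B hA hB
  | single r F =>
    have : (Finsupp.single r F : SD) = ∑ i, ∑ k, el i k r (F i k) := by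
      conv_lhs => rw [Matrix.matrix_eq_sum_single F]
      simp only [el, ← Finsupp.singleAddHom_apply, map_sum]
    rw [this]
    have hs : ∀ (s : Finset (Fin 2)) (g : Fin 2 → SD), (∀ i, motive (g i)) →
        motive (∑ i ∈ s, g i) := fun s g hg =>
      Finset.sum_induction g motive hadd h0 fun i _ => hg i
    exact hs _ _ fun i => hs _ _ fun k => hel i k r _

theorem negShift_taylor (a s : ℂ) (f : ℂ[X]) : negShift a (taylor s f) = negShift (a + s) f := by
  simp only [negShift, taylor_apply, aeval_def, algebraMap_eq, ← comp.eq_1, comp_assoc]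
  congr 1
  simp; ring

theorem taylor_negShift (a s : ℂ) (f : ℂ[X]) : taylor s (negShift a f) = negShift (a - s) f := by
  simp only [negShift, taylor_apply, aeval_def, algebraMap_eq, ← comp.eq_1, comp_assoc]
  congr 1
  simp; ring

theorem sigma_part (p : Fin 2) (A : SD) : sigma (part p A) = part p (sigma A) := by
  induction A using induction_el with
  | h0 => simp
  | hadd A B hA hB => simp [hA, hB]
  | hel i k r f =>
    rw [part_el, sigma_el, map_smul, part_el]
    by_cases h : i + k = p
    · have h' : k + i = p := by rwa [add_comm]
      simp only [if_pos h, if_pos h', sigma_el]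
    · have h' : ¬k + i = p := by rwa [add_comm]
      simp only [if_neg h, if_neg h', smul_zero, map_zero]

/-- `σ` is an anti-automorphism of the associative superalgebra. -/
theorem sigma_mul (p q : Fin 2) (A B : SD) :
    sigma (mul (part p A) (part q B))
      = (-1 : ℂ) ^ (p.val * q.val) • mul (sigma (part q B)) (sigma (part p A)) := by
  induction A using induction_el with
  | h0 => simp
  | hadd A A' hA hA' => simp only [map_add, LinearMap.add_apply, hA, hA', smul_add]
  | hel i k r f =>
    induction B using induction_el with
    | h0 => simp
    | hadd B B' hB hB' => simp only [map_add, LinearMap.add_apply, hB, hB', smul_add]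
    | hel l m s g =>
      rw [part_el, part_el]
      by_cases h1 : i + k = p
      swap
      · simp [h1]
      by_cases h2 : l + m = q
      swap
      · simp [h2]
      rw [if_pos h1, if_pos h2, mul_el, sigma_el, sigma_el, map_smul, map_smul,
        LinearMap.smul_apply, mul_el]
      by_cases h3 : k = l
      swap
      · rw [if_neg h3, if_neg (Ne.symm h3)]; simp
      subst h3 h1 h2
      rw [if_pos rfl, if_pos rfl, sigma_el, map_mul, negShift_taylor, taylor_negShift, smul_smul,
        smul_smul, zpow_add₀ (by norm_num : (-1 : ℂ) ≠ 0)]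
      have hr : s + (k.val : ℤ) - m.val + (r + i.val - k.val) = r + s + i.val - m.val := by ring
      rw [hr]
      have hf : (-((r + s : ℤ) : ℂ) - i.val + s) = -r - i.val := by push_cast; ring
      have hg : (-(s : ℂ) - k.val - ((r + i.val - k.val : ℤ) : ℂ)) = -((r + s : ℤ) : ℂ) - i.val := by
        push_cast; ring
      rw [hf, hg, mul_comm (negShift _ g)]
      congr 1
      fin_cases i <;> fin_cases k <;> fin_cases m <;> simp

theorem sigma_sigma (A : SD) : sigma (sigma A) = A := by
  induction A using induction_el with
  | h0 => simp
  | hadd A B hA hB => simp [hA, hB]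
  | hel i k r f =>
    rw [sigma_el, map_smul, sigma_el, smul_smul]
    have hr : r + (i.val : ℤ) - k.val + k.val - i.val = r := by ring
    have hf : negShift (-((r + i.val - k.val : ℤ) : ℂ) - k.val) (negShift (-r - (i.val : ℂ)) f) = f := by
      simp only [negShift, aeval_def, algebraMap_eq, ← comp.eq_1, comp_assoc]
      conv_rhs => rw [← comp_X (p := f)]
      congr 1
      simp
      ring
    rw [hr, hf]
    have hz : (-1 : ℂ) ^ r * (-1 : ℂ) ^ r = 1 := by
      rw [← mul_zpow]; simp
    fin_cases i <;> fin_cases k <;>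
      simp [zpow_add₀, zpow_sub₀, div_neg, hz]

theorem sum_part (A : SD) : ∑ p : Fin 2, part p A = A := by
  induction A using induction_el with
  | h0 => simp
  | hadd A B hA hB => simp only [map_add, Finset.sum_add_distrib, hA, hB]
  | hel i k r f => simp [part_el]

end SD

open SD

/-- The Lie superalgebra `⁰SD` of all `A` with `σ_{-1,1}(A) = -A`. -/
def SD0 : Submodule ℂ SD where
  carrier := {A | sigma A = -A}
  zero_mem' := by simp
  add_mem' := by
    intro A B hA hB
    simp only [Set.mem_ofPred_eq] at *
    rw [map_add, hA, hB]; abel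
  smul_mem' := by
    intro c A hA
    simp only [Set.mem_ofPred_eq] at *
    rw [map_smul, hA, smul_neg]

theorem bracket_mem {A B : SD} (hA : A ∈ SD0) (hB : B ∈ SD0) : bracket A B ∈ SD0 := by
  change sigma (bracket A B) = -bracket A B
  have hA' : ∀ p, sigma (part p A) = -part p A := fun p => by
    rw [sigma_part, show sigma A = -A from hA, map_neg]
  have hB' : ∀ p, sigma (part p B) = -part p B := fun p => by
    rw [sigma_part, show sigma B = -B from hB, map_neg]
  have e : mul A B = ∑ p : Fin 2, ∑ q : Fin 2, mul (part p A) (part q B) := by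
    conv_lhs => rw [← sum_part A, ← sum_part B]
    simp only [map_sum, LinearMap.sum_apply]
    exact Finset.sum_comm
  simp only [bracket, e, map_sub, map_sum, map_smul, sigma_mul, hA', hB', map_neg,
    LinearMap.neg_apply, neg_neg, smul_smul, neg_sub]
  congr 1
  refine Finset.sum_congr rfl fun p _ => Finset.sum_congr rfl fun q _ => ?_
  rw [mul_comm q.val p.val, ← mul_pow]; simp

/-- The central extension `⁰SD^` of `⁰SD`; the pair `(A, c)` is `A + c C`. -/
abbrev HatSD0 : Type := SD0 × ℂ

namespace HatSD0

/-- The super-bracket `[A + a C, B + b C] = [A, B] + Ψ(A, B) C`. -/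
def bracket (x y : HatSD0) : HatSD0 :=
  (⟨SD.bracket x.1 y.1, bracket_mem x.1.2 y.1.2⟩, cocycle x.1 y.1)

/-- The subspace of elements of parity `p`; the central element is even. -/
def parity (p : Fin 2) : Submodule ℂ HatSD0 where
  carrier := {x | part p (x.1 : SD) = x.1 ∧ (p ≠ 0 → x.2 = 0)}
  zero_mem' := by simp
  add_mem' := by
    rintro x y ⟨hx, hx'⟩ ⟨hy, hy'⟩
    refine ⟨by simp [hx, hy], fun h => by simp [hx' h, hy' h]⟩
  smul_mem' := by
    rintro c x ⟨hx, hx'⟩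
    refine ⟨by simp [hx], fun h => by simp [hx' h]⟩

/-- The principal gradation, with doubled degrees: `grade n` is the subspace of weight `n / 2`.
The weights are `1` for `t`, `0` for `D` and `C`, `1/2` for `θ` and `-1/2` for `∂_θ`, so
`t ^ r f(D) M_{ik}` has weight `(2 r + i - k) / 2`. -/
def grade (n : ℤ) : Submodule ℂ HatSD0 where
  carrier := {x | (∀ (r : ℤ) (i k : Fin 2), 2 * r + i.val - k.val ≠ n → (x.1 : SD) r i k = 0) ∧
    (n ≠ 0 → x.2 = 0)}
  zero_mem' := by simp
  add_mem' := by
    rintro x y ⟨hx, hx'⟩ ⟨hy, hy'⟩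
    refine ⟨fun r i k h => by simp [hx r i k h, hy r i k h], fun h => by simp [hx' h, hy' h]⟩
  smul_mem' := by
    rintro c x ⟨hx, hx'⟩
    refine ⟨fun r i k h => by simp [hx r i k h], fun h => by simp [hx' h]⟩

theorem el_mem (i : Fin 2) (f : ℂ[X]) (hf : negShift (-(i.val : ℂ)) f = -f) :
    el i i 0 f ∈ SD0 := by
  change sigma (el i i 0 f) = -el i i 0 f
  have h : ¬(i = 0 ∧ i = 1) := by rintro ⟨rfl, h⟩; exact absurd h (by decide)
  rw [sigma_el, if_neg h]
  simp [hf, el, ← Matrix.single_neg]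

theorem el_mem_grade (i : Fin 2) (f : ℂ[X]) (hf : negShift (-(i.val : ℂ)) f = -f) :
    ((⟨el i i 0 f, el_mem i f hf⟩, 0) : HatSD0) ∈ grade 0 := by
  refine ⟨fun r a b h => ?_, fun _ => rfl⟩
  by_cases hr : r = 0
  · subst hr
    have : ¬(i = a ∧ i = b) := by
      rintro ⟨rfl, rfl⟩; simp at h
    simp [el, this]
  · simp [el, Ne.symm hr]

/-- `∂_θ θ (D ^ n - (-D) ^ n) / 2`, that is, `n!` times the coefficient of `x ^ n` in
`∂_θ θ sinh(x D)`. -/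
def sinh₀ (n : ℕ) : grade 0 :=
  ⟨(⟨el 0 0 0 (C (1 / 2) * (X ^ n - (-X) ^ n)), el_mem _ _ (by simp [negShift]; ring)⟩, 0),
    el_mem_grade _ _ (by simp [negShift]; ring)⟩

/-- `θ ∂_θ ((D + 1/2) ^ n - (-(D + 1/2)) ^ n) / 2`, that is, `n!` times the coefficient of `x ^ n`
in `θ ∂_θ sinh(x (D + 1/2))`. -/
def sinh₁ (n : ℕ) : grade 0 :=
  have h : negShift (-((1 : Fin 2).val : ℂ))
      (C (1 / 2) * ((X + C (1 / 2)) ^ n - (-(X + C (1 / 2))) ^ n))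
      = -(C (1 / 2) * ((X + C (1 / 2)) ^ n - (-(X + C (1 / 2))) ^ n)) := by
    have e : (C (-1) - X + C (1 / 2) : ℂ[X]) = -(X + C (1 / 2)) := by
      have : (C (-1) : ℂ[X]) = -C (1 / 2) - C (1 / 2) := by
        rw [← C_neg, ← C_sub]; norm_num
      rw [this]; ring
    simp only [negShift, map_mul, map_sub, map_pow, map_neg, map_add, aeval_X, aeval_C,
      algebraMap_eq, Fin.val_one, Nat.cast_one]
    rw [← C_neg, e]; ring
  ⟨(⟨el 1 1 0 _, el_mem _ _ h⟩, 0), el_mem_grade _ _ h⟩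

/-- The central element `C`. -/
def central : grade 0 := ⟨(0, 1), by simp [grade]⟩

/-- The formal power series `⁰Δ₀(x) = -ξ(∂_θ θ sinh(x D))`. -/
def Delta₀ (ξ : Module.Dual ℂ (grade 0)) : PowerSeries ℂ :=
  PowerSeries.mk fun n => -ξ (sinh₀ n) / (n.factorial : ℂ)

/-- The formal power series `⁰Δ₁(x) = -ξ(θ ∂_θ sinh(x (D + 1/2)))`. -/
def Delta₁ (ξ : Module.Dual ℂ (grade 0)) : PowerSeries ℂ :=
  PowerSeries.mk fun n => -ξ (sinh₁ n) / (n.factorial : ℂ)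

/-- The formal power series `e^{x/2}`. -/
def expHalf : PowerSeries ℂ := PowerSeries.rescale (1 / 2 : ℂ) (PowerSeries.exp ℂ)

/-- `α(d/dx)`, acting on formal power series. -/
def diffOp (α : ℂ[X]) : Module.End ℂ (PowerSeries ℂ) :=
  aeval ((PowerSeries.derivative ℂ : Derivation ℂ (PowerSeries ℂ) (PowerSeries ℂ)) :
    PowerSeries ℂ →ₗ[ℂ] PowerSeries ℂ) α

/-- `V`, with the action `ρ`, the grading `𝒱` (`𝒱 n` is the component of degree `n / 2`) and the
vector `v`, is the irreducible highest weight module of highest weight `ξ`: a graded module over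
the Lie superalgebra, irreducible, with `v` a nonzero vector of degree `0` that is annihilated by all
elements of positive weight and on which the Cartan subalgebra `grade 0` acts through `ξ`. -/
structure IsIrreducibleHighestWeight {V : Type*} [AddCommGroup V] [Module ℂ V]
    (ξ : Module.Dual ℂ (grade 0)) (ρ : HatSD0 →ₗ[ℂ] Module.End ℂ V) (𝒱 : ℤ → Submodule ℂ V)
    (v : V) : Prop where
  map_bracket : ∀ (p q : Fin 2) (x y : HatSD0), x ∈ parity p → y ∈ parity q →
    ρ (bracket x y) = ρ x * ρ y - (-1 : ℂ) ^ (p.val * q.val) • (ρ y * ρ x)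
  isInternal : DirectSum.IsInternal 𝒱
  map_grade : ∀ (m n : ℤ) (x : HatSD0) (u : V), x ∈ grade m → u ∈ 𝒱 n → ρ x u ∈ 𝒱 (m + n)
  irreducible : ∀ W : Submodule ℂ V, (∀ x, ∀ u ∈ W, ρ x u ∈ W) → W = ⊥ ∨ W = ⊤
  ne_zero : v ≠ 0
  mem_zero : v ∈ 𝒱 0
  annihilated : ∀ n : ℤ, 0 < n → ∀ x ∈ grade n, ρ x v = 0
  weight : ∀ h : grade 0, ρ (h : HatSD0) v = ξ h • v

/-- All graded components are finite-dimensional. -/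
def IsQuasifinite {V : Type*} [AddCommGroup V] [Module ℂ V] (𝒱 : ℤ → Submodule ℂ V) : Prop :=
  ∀ n : ℤ, FiniteDimensional ℂ (𝒱 n)

end HatSD0

end SuperCircle

end

noncomputable section

namespace SuperCircle

namespace SD

/-! Write x_f and y_f for `hatSkew (el 1 0 0 f)` and `hatSkew (el 1 0 (-1) f)`, of weights 1/2 and
-1/2. Since σ exchanges θ-terms and ∂_θ-terms up to sign, these elements exhaust their weight
spaces. The bracket [x_f, y_g] depends only on the product f(D) g(-D), through the linear map
`cartan` into the Cartan subalgebra. In an irreducible module a vector of negative weight killed by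
all positive weights is zero (`singular_eq_zero`), so y_α v = 0 exactly when ξ ∘ `cartan` vanishes
on the ideal generated by α(-w) (`theta_apply_eq_zero_iff`).

If the module is quasifinite, f ↦ y_f v maps the infinite-dimensional space ℂ[w] into the
finite-dimensional L_{-1/2}, so y_α v = 0 for some α ≠ 0. Conversely, one such relation spreads by
brackets to all negative weights: for each type of symbol, all multiples of some nonzero polynomial
annihilate v (`exists_theta_apply_eq_zero`, `diag_apply_eq_zero`). Hence every weight space of the
algebra sends v into a finite-dimensional space; commuting operators extends this to all vectors,
and each L_n, reached from v by boundedly many lowering steps, is finite-dimensional.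

Finally, ξ(cartan((-w)^n)) is 2 n! times the n-th coefficient of the series in the theorem
(`two_mul_factorial_mul_coeff`). So α(d/dx) annihilates the series exactly when ξ ∘ `cartan`
vanishes on every (-w)^n α(-w), hence on the whole ideal (`diffOp_eq_zero_iff`). -/

/-! ### Elementary operators as functions of their symbols -/

theorem el_neg (i k : Fin 2) (r : ℤ) (f : ℂ[X]) : el i k r (-f) = -el i k r f := by
  simp [el, ← Matrix.single_neg]

theorem el_smul (i k : Fin 2) (r : ℤ) (c : ℂ) (f : ℂ[X]) : el i k r (c • f) = c • el i k r f := by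
  simp [el, ← Matrix.smul_single]

theorem el_sub (i k : Fin 2) (r : ℤ) (f g : ℂ[X]) :
    el i k r (f - g) = el i k r f - el i k r g := by
  rw [sub_eq_add_neg, el_add, el_neg, sub_eq_add_neg]

/-- `f ↦ t ^ r f(D) M_{ik}` as a linear map. -/
def elₗ (i k : Fin 2) (r : ℤ) : ℂ[X] →ₗ[ℂ] SD where
  toFun := el i k r
  map_add' := el_add i k r
  map_smul' := el_smul i k r

theorem elₗ_apply (i k : Fin 2) (r : ℤ) (f : ℂ[X]) : elₗ i k r f = el i k r f := rfl

theorem el_apply_of_ne {i k a b : Fin 2} {r s : ℤ} (f : ℂ[X]) (h : ¬(r = s ∧ i = a ∧ k = b)) :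
    el i k r f s a b = 0 := by
  by_cases hr : r = s
  · subst hr
    rw [el, Finsupp.single_eq_same, Matrix.single_apply, if_neg (fun h' => h ⟨rfl, h'⟩)]
  · rw [el, Finsupp.single_eq_of_ne (Ne.symm hr)]; rfl

/-! ### Linearity of the bracket -/

theorem bracket_add_left (A A' B : SD) : bracket (A + A') B = bracket A B + bracket A' B := by
  simp only [bracket, map_add, LinearMap.add_apply, smul_add, Finset.sum_add_distrib]
  abel

theorem bracket_add_right (A B B' : SD) : bracket A (B + B') = bracket A B + bracket A B' := by
  simp only [bracket, map_add, LinearMap.add_apply, smul_add, Finset.sum_add_distrib]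
  abel

theorem bracket_smul_left (c : ℂ) (A B : SD) : bracket (c • A) B = c • bracket A B := by
  simp only [bracket, map_smul, LinearMap.smul_apply, smul_sub, Finset.smul_sum, smul_comm c]

theorem bracket_smul_right (c : ℂ) (A B : SD) : bracket A (c • B) = c • bracket A B := by
  simp only [bracket, map_smul, LinearMap.smul_apply, smul_sub, Finset.smul_sum, smul_comm c]

theorem bracket_neg_left (A B : SD) : bracket (-A) B = -bracket A B := by
  rw [← neg_one_smul ℂ, bracket_smul_left, neg_one_smul]

theorem bracket_neg_right (A B : SD) : bracket A (-B) = -bracket A B := by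
  rw [← neg_one_smul ℂ, bracket_smul_right, neg_one_smul]

theorem bracket_sub_left (A A' B : SD) : bracket (A - A') B = bracket A B - bracket A' B := by
  rw [sub_eq_add_neg, bracket_add_left, bracket_neg_left, sub_eq_add_neg]

theorem bracket_sub_right (A B B' : SD) : bracket A (B - B') = bracket A B - bracket A B' := by
  rw [sub_eq_add_neg, bracket_add_right, bracket_neg_right, sub_eq_add_neg]

theorem bracket_el (i k l m : Fin 2) (r s : ℤ) (f g : ℂ[X]) :
    bracket (el i k r f) (el l m s g) = mul (el i k r f) (el l m s g)
      - (-1 : ℂ) ^ ((i + k).val * (l + m).val) • mul (el l m s g) (el i k r f) := by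
  rw [bracket, Finset.sum_eq_single (i + k), Finset.sum_eq_single (l + m)]
  · rw [part_el, part_el, if_pos rfl, if_pos rfl]
  · intro q _ hq
    rw [part_el q, if_neg (Ne.symm hq)]; simp
  · simp
  · intro p _ hp
    refine Finset.sum_eq_zero fun q _ => ?_
    rw [part_el p, if_neg (Ne.symm hp)]; simp
  · simp

theorem mul_eq_sum_part (A B : SD) :
    mul A B = ∑ p : Fin 2, ∑ q : Fin 2, mul (part p A) (part q B) := by
  conv_lhs => rw [← sum_part A, ← sum_part B]
  simp only [map_sum, LinearMap.sum_apply]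
  exact Finset.sum_comm

theorem sigma_bracket (A B : SD) : sigma (bracket A B) = -bracket (sigma A) (sigma B) := by
  simp only [bracket, mul_eq_sum_part A B, mul_eq_sum_part (sigma A) (sigma B), map_sub, map_sum,
    map_smul, sigma_mul, sigma_part, smul_smul, neg_sub]
  congr 1
  refine Finset.sum_congr rfl fun p _ => Finset.sum_congr rfl fun q _ => ?_
  rw [mul_comm q.val p.val, ← mul_pow]; simp

/-! ### The projection onto `⁰SD` -/

/-- The map `A ↦ A - σ(A)`, which is twice the projection onto `⁰SD`. -/
def skew : SD →ₗ[ℂ] SD0 :=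
  (LinearMap.id - sigma).codRestrict SD0 fun A => by
    change sigma (A - sigma A) = -(A - sigma A)
    rw [map_sub, sigma_sigma, neg_sub]

theorem coe_skew (A : SD) : (skew A : SD) = A - sigma A := rfl

theorem skew_coe (A : SD0) : skew A = (2 : ℂ) • A := by
  apply Subtype.ext
  have h : sigma (A : SD) = -A := A.2
  rw [coe_skew, h, sub_neg_eq_add, Submodule.coe_smul, two_smul]

theorem skew_sigma (A : SD) : skew (sigma A) = (-1 : ℂ) • skew A := by
  apply Subtype.ext
  rw [Submodule.coe_smul, coe_skew, coe_skew, sigma_sigma, neg_one_smul, neg_sub]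

/-- Because σ(B) = -B, `sigma_bracket` gives σ[A, B] = [σA, B], so bracketing with B commutes with
`skew`. Brackets inside ⁰SD can thus be computed with one factor left unsymmetrized. -/
theorem bracket_skew_left (A : SD) (B : SD0) :
    bracket (skew A) B = skew (bracket A B) := by
  have h : sigma (B : SD) = -B := B.2
  rw [coe_skew, coe_skew, bracket_sub_left, sigma_bracket, h, bracket_neg_right, neg_neg]

theorem bracket_skew_right (A : SD0) (B : SD) :
    bracket A (skew B) = skew (bracket A B) := by
  have h : sigma (A : SD) = -A := A.2
  rw [coe_skew, coe_skew, bracket_sub_right, sigma_bracket, h, bracket_neg_left, neg_neg]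

/-! ### Homogeneous operators -/

/-- The operators of weight `n / 2`. -/
def homog (n : ℤ) : Submodule ℂ SD where
  carrier := {A | ∀ (r : ℤ) (i k : Fin 2), 2 * r + i.val - k.val ≠ n → A r i k = 0}
  zero_mem' := by simp
  add_mem' := by
    intro x y hx hy r i k h
    simp [hx r i k h, hy r i k h]
  smul_mem' := by
    intro c x hx r i k h
    simp [hx r i k h]

theorem el_mem_homog (i k : Fin 2) (r : ℤ) (f : ℂ[X]) :
    el i k r f ∈ homog (2 * r + i.val - k.val) := by
  intro s a b h
  refine el_apply_of_ne f ?_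
  rintro ⟨rfl, rfl, rfl⟩
  exact h rfl

theorem homog_induction {n : ℤ} {motive : SD → Prop} (h0 : motive 0)
    (hadd : ∀ A B, motive A → motive B → motive (A + B))
    (hel : ∀ i k r f, 2 * r + (i.val : ℤ) - (k.val : ℤ) = n → motive (el i k r f))
    {A : SD} (hA : A ∈ homog n) : motive A := by
  have e : A = ∑ r ∈ A.support, ∑ i, ∑ k, el i k r (A r i k) := by
    conv_lhs => rw [← Finsupp.sum_single A, Finsupp.sum]
    refine Finset.sum_congr rfl fun r _ => ?_
    conv_lhs => rw [Matrix.matrix_eq_sum_single (A r)]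
    simp only [el, ← Finsupp.singleAddHom_apply, map_sum]
  rw [e]
  refine Finset.sum_induction _ motive hadd h0 fun r _ =>
    Finset.sum_induction _ motive hadd h0 fun i _ =>
    Finset.sum_induction _ motive hadd h0 fun k _ => ?_
  by_cases h : 2 * r + (i.val : ℤ) - (k.val : ℤ) = n
  · exact hel i k r _ h
  · rw [hA r i k h]
    simpa [el] using h0

theorem sigma_mem_homog {n : ℤ} {A : SD} (hA : A ∈ homog n) : sigma A ∈ homog n := by
  refine homog_induction (motive := fun A => sigma A ∈ homog n) (by simp)
    (fun A B hA hB => by rw [map_add]; exact add_mem hA hB) (fun i k r f h => ?_) hA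
  rw [sigma_el]
  refine Submodule.smul_mem _ _ ?_
  have h' := el_mem_homog k i (r + i.val - k.val) (negShift (-r - (i.val : ℂ)) f)
  rwa [show 2 * (r + (i.val : ℤ) - k.val) + k.val - i.val = n by linarith] at h'

theorem mul_mem_homog {m n : ℤ} {A B : SD} (hA : A ∈ homog m) (hB : B ∈ homog n) :
    mul A B ∈ homog (m + n) := by
  refine homog_induction (motive := fun A => mul A B ∈ homog (m + n)) (by simp)
    (fun A B hA hB => by rw [map_add]; exact add_mem hA hB) (fun i k r f h => ?_) hA
  refine homog_induction (motive := fun B => mul _ B ∈ homog (m + n)) (by simp)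
    (fun A B hA hB => by rw [map_add]; exact add_mem hA hB) (fun l q s g h' => ?_) hB
  rw [mul_el]
  split_ifs with hkl
  · subst hkl
    have h'' := el_mem_homog i q (r + s) (taylor (s : ℂ) f * g)
    rwa [show 2 * (r + s) + (i.val : ℤ) - q.val = m + n by linarith] at h''
  · exact zero_mem _

theorem part_mem_homog {n : ℤ} (p : Fin 2) {A : SD} (hA : A ∈ homog n) : part p A ∈ homog n := by
  refine homog_induction (motive := fun A => part p A ∈ homog n) (by simp)
    (fun A B hA hB => by rw [map_add]; exact add_mem hA hB) (fun i k r f h => ?_) hA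
  rw [part_el]
  split_ifs
  · exact h ▸ el_mem_homog i k r f
  · exact zero_mem _

theorem bracket_mem_homog {m n : ℤ} {A B : SD} (hA : A ∈ homog m) (hB : B ∈ homog n) :
    bracket A B ∈ homog (m + n) := by
  refine sub_mem (mul_mem_homog hA hB) (sum_mem fun p _ => sum_mem fun q _ =>
    Submodule.smul_mem _ _ ?_)
  rw [add_comm]
  exact mul_mem_homog (part_mem_homog q hB) (part_mem_homog p hA)

/-- The doubled weight 2r + i - k is congruent to i + k modulo 2, so the weight determines the
superparity. -/
theorem part_of_mem_homog {n : ℤ} {p : Fin 2} (hp : n % 2 = p.val) {A : SD} (hA : A ∈ homog n) :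
    part p A = A := by
  refine homog_induction (motive := fun A => part p A = A) (by simp)
    (fun A B hA hB => by rw [map_add, hA, hB]) (fun i k r f h => ?_) hA
  rw [part_el, if_pos]
  ext
  rw [Fin.val_add]
  omega

/-! ### The cocycle -/

theorem strEval_add_left (F F' G : Matrix (Fin 2) (Fin 2) ℂ[X]) (a b : ℂ) :
    strEval (F + F') G a b = strEval F G a b + strEval F' G a b := by
  simp [strEval, Matrix.mul_apply, Matrix.map_apply]; ring

theorem strEval_add_right (F G G' : Matrix (Fin 2) (Fin 2) ℂ[X]) (a b : ℂ) :
    strEval F (G + G') a b = strEval F G a b + strEval F G' a b := by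
  simp [strEval, Matrix.mul_apply, Matrix.map_apply]; ring

theorem strEval_zero_left (G : Matrix (Fin 2) (Fin 2) ℂ[X]) (a b : ℂ) : strEval 0 G a b = 0 := by
  simp [strEval, Matrix.mul_apply]

theorem strEval_zero_right (F : Matrix (Fin 2) (Fin 2) ℂ[X]) (a b : ℂ) : strEval F 0 a b = 0 := by
  simp [strEval, Matrix.mul_apply]

/-- The value of the cocycle on `t ^ r F(D)`, `t ^ s G(D)`. -/
def cocycleTerm (r : ℤ) (F : Matrix (Fin 2) (Fin 2) ℂ[X]) (s : ℤ)
    (G : Matrix (Fin 2) (Fin 2) ℂ[X]) : ℂ :=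
  if r + s ≠ 0 then 0
  else if 0 ≤ r then ∑ j ∈ Finset.Ico (-r) 0, strEval F G (j : ℂ) ((j + r : ℤ) : ℂ)
  else -∑ j ∈ Finset.Ico 0 (-r), strEval F G (j : ℂ) ((j + r : ℤ) : ℂ)

theorem cocycle_eq_sum (A B : SD) :
    cocycle A B = A.sum fun r F => B.sum fun s G => cocycleTerm r F s G := rfl

theorem cocycleTerm_zero_left (r s : ℤ) (G : Matrix (Fin 2) (Fin 2) ℂ[X]) :
    cocycleTerm r 0 s G = 0 := by
  simp [cocycleTerm, strEval_zero_left]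

theorem cocycleTerm_zero_right (r s : ℤ) (F : Matrix (Fin 2) (Fin 2) ℂ[X]) :
    cocycleTerm r F s 0 = 0 := by
  simp [cocycleTerm, strEval_zero_right]

theorem cocycleTerm_add_left (r s : ℤ) (F F' G : Matrix (Fin 2) (Fin 2) ℂ[X]) :
    cocycleTerm r (F + F') s G = cocycleTerm r F s G + cocycleTerm r F' s G := by
  simp only [cocycleTerm, strEval_add_left, Finset.sum_add_distrib]
  split_ifs <;> ring

theorem cocycleTerm_add_right (r s : ℤ) (F G G' : Matrix (Fin 2) (Fin 2) ℂ[X]) :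
    cocycleTerm r F s (G + G') = cocycleTerm r F s G + cocycleTerm r F s G' := by
  simp only [cocycleTerm, strEval_add_right, Finset.sum_add_distrib]
  split_ifs <;> ring

theorem cocycle_add_left (A A' B : SD) : cocycle (A + A') B = cocycle A B + cocycle A' B := by
  simp only [cocycle_eq_sum]
  refine Finsupp.sum_add_index' (fun r => ?_) (fun r F F' => ?_)
  · simp [cocycleTerm_zero_left]
  · simp only [cocycleTerm_add_left, Finsupp.sum_add]

theorem cocycle_add_right (A B B' : SD) : cocycle A (B + B') = cocycle A B + cocycle A B' := by
  simp only [cocycle_eq_sum]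
  rw [← Finsupp.sum_add]
  exact Finsupp.sum_congr fun r _ => Finsupp.sum_add_index'
    (fun s => cocycleTerm_zero_right _ _ _) (fun s G G' => cocycleTerm_add_right _ _ _ _ _)

theorem cocycle_el (i k l m : Fin 2) (r s : ℤ) (f g : ℂ[X]) :
    cocycle (el i k r f) (el l m s g)
      = cocycleTerm r (Matrix.single i k f) s (Matrix.single l m g) := by
  rw [cocycle_eq_sum, el, el, Finsupp.sum_single_index, Finsupp.sum_single_index]
  · exact cocycleTerm_zero_right _ _ _
  · simp [cocycleTerm_zero_left]

theorem cocycle_el_of_ne {i k l m : Fin 2} {r s : ℤ} (h : i ≠ m ∨ k ≠ l ∨ r + s ≠ 0 ∨ r = 0)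
    (f g : ℂ[X]) : cocycle (el i k r f) (el l m s g) = 0 := by
  have hstr : i ≠ m ∨ k ≠ l → ∀ a b,
      strEval (Matrix.single i k f) (Matrix.single l m g) a b = 0 := by
    intro h a b
    simp only [strEval, Matrix.mul_apply, Matrix.map_apply, Matrix.single_apply, Fin.sum_univ_two]
    fin_cases i <;> fin_cases k <;> fin_cases l <;> fin_cases m <;> simp at h ⊢
  rw [cocycle_el, cocycleTerm]
  rcases or_assoc.2 h with h | h | rfl
  · simp [hstr h]
  · rw [if_pos h]
  · simp

theorem cocycle_eq_zero {m n : ℤ} (h : m + n ≠ 0) {A B : SD} (hA : A ∈ homog m)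
    (hB : B ∈ homog n) : cocycle A B = 0 := by
  refine homog_induction (motive := fun A => cocycle A B = 0) (by simp [cocycle])
    (fun A B hA hB => by rw [cocycle_add_left, hA, hB, add_zero]) (fun i k r f hr => ?_) hA
  refine homog_induction (motive := fun B => cocycle _ B = 0) (by simp [cocycle])
    (fun A B hA hB => by rw [cocycle_add_right, hA, hB, add_zero]) (fun l q s g hs => ?_) hB
  refine cocycle_el_of_ne ?_ f g
  by_contra! h'
  obtain ⟨rfl, rfl, h', -⟩ := h'
  exact h (by linarith)

end SD

namespace HatSD0

open SD

/-! ### Lifting symbols to the central extension -/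

/-- The element `A - σ(A)` of `⁰SD`, in the central extension. -/
def hatSkew : SD →ₗ[ℂ] HatSD0 := LinearMap.inl ℂ SD0 ℂ ∘ₗ skew

theorem hatSkew_apply (A : SD) : hatSkew A = (skew A, 0) := rfl

theorem hatSkew_sigma (A : SD) : hatSkew (sigma A) = (-1 : ℂ) • hatSkew A := by
  rw [hatSkew, LinearMap.comp_apply, skew_sigma, map_smul, LinearMap.comp_apply]

theorem hatSkew_mem_grade {n : ℤ} {A : SD} (hA : A ∈ homog n) : hatSkew A ∈ grade n :=
  ⟨sub_mem hA (sigma_mem_homog hA), fun _ => rfl⟩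

theorem hatSkew_el_mem_grade {i k : Fin 2} {r n : ℤ} (h : 2 * r + i.val - k.val = n) (f : ℂ[X]) :
    hatSkew (el i k r f) ∈ grade n :=
  hatSkew_mem_grade (h ▸ el_mem_homog i k r f)

theorem bracket_mem_grade {m n : ℤ} {x y : HatSD0} (hx : x ∈ grade m) (hy : y ∈ grade n) :
    bracket x y ∈ grade (m + n) :=
  ⟨bracket_mem_homog hx.1 hy.1, fun h => cocycle_eq_zero h hx.1 hy.1⟩

theorem mem_parity_of_mem_grade {n : ℤ} {p : Fin 2} (hp : n % 2 = p.val) {x : HatSD0}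
    (hx : x ∈ grade n) : x ∈ parity p := by
  refine ⟨part_of_mem_homog hp hx.1, fun h => hx.2 ?_⟩
  rintro rfl
  apply h
  ext
  simpa using hp.symm

theorem exists_parity (n : ℤ) : ∃ p : Fin 2, n % 2 = p.val :=
  ⟨⟨(n % 2).toNat, by omega⟩, by simp; omega⟩

theorem eq_hatSkew (x : HatSD0) : x = (2⁻¹ : ℂ) • hatSkew x.1 + x.2 • (central : HatSD0) := by
  apply Prod.ext
  · simp [hatSkew_apply, skew_coe, central]
  · simp [hatSkew_apply, central]

theorem iSup_grade : ⨆ n, grade n = ⊤ := by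
  rw [eq_top_iff]
  rintro x -
  have h : ∀ A, hatSkew A ∈ ⨆ n, grade n := by
    intro A
    refine induction_el (motive := fun A => hatSkew A ∈ ⨆ n, grade n) (by simp)
      (fun A B hA hB => by rw [map_add]; exact add_mem hA hB) (fun i k r f => ?_) A
    exact Submodule.mem_iSup_of_mem _ (hatSkew_el_mem_grade rfl f)
  rw [eq_hatSkew x]
  exact add_mem (Submodule.smul_mem _ _ (h _))
    (Submodule.smul_mem _ _ (Submodule.mem_iSup_of_mem 0 central.2))

/-- Elements of nonzero weight are combinations of the `el i k r f - σ(el i k r f)`. -/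
theorem grade_induction {n : ℤ} (hn : n ≠ 0) {motive : HatSD0 → Prop} (h0 : motive 0)
    (hadd : ∀ x y, motive x → motive y → motive (x + y))
    (hel : ∀ i k r f, 2 * r + (i.val : ℤ) - (k.val : ℤ) = n → motive (hatSkew (el i k r f)))
    {x : HatSD0} (hx : x ∈ grade n) : motive x := by
  have e : x = hatSkew ((2⁻¹ : ℂ) • (x.1 : SD)) := by
    conv_lhs => rw [eq_hatSkew x, hx.2 hn]
    simp
  rw [e]
  refine homog_induction (motive := fun A => motive (hatSkew A)) (by simpa using h0)
    (fun A B hA hB => by rw [map_add]; exact hadd _ _ hA hB) hel (Submodule.smul_mem _ _ hx.1)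

theorem bracket_hatSkew_left (A : SD) (y : HatSD0) :
    bracket (hatSkew A) y
      = hatSkew (SD.bracket A y.1) + cocycle (hatSkew A).1 y.1 • (central : HatSD0) := by
  apply Prod.ext
  · apply Subtype.ext
    simpa [bracket, hatSkew_apply, central] using bracket_skew_left A y.1
  · simp [bracket, hatSkew_apply, central]

theorem bracket_hatSkew_right (x : HatSD0) (B : SD) :
    bracket x (hatSkew B)
      = hatSkew (SD.bracket x.1 B) + cocycle x.1 (hatSkew B).1 • (central : HatSD0) := by
  apply Prod.ext
  · apply Subtype.ext
    simpa [bracket, hatSkew_apply, central] using bracket_skew_right x.1 B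
  · simp [bracket, hatSkew_apply, central]

/-! ### Highest weight modules -/

/-- `IsDescendant ρ T d u`: the vector `u` is obtained from `T` by operators of negative weight of
total degree `d`. -/
inductive IsDescendant {V : Type*} [AddCommGroup V] [Module ℂ V] (ρ : HatSD0 →ₗ[ℂ] Module.End ℂ V)
    (T : Submodule ℂ V) : ℤ → V → Prop
  | zero (d : ℤ) : IsDescendant ρ T d 0
  | add {d : ℤ} {u w : V} : IsDescendant ρ T d u → IsDescendant ρ T d w →
      IsDescendant ρ T d (u + w)
  | smul {d : ℤ} (c : ℂ) {u : V} : IsDescendant ρ T d u → IsDescendant ρ T d (c • u)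
  | base {u : V} : u ∈ T → IsDescendant ρ T 0 u
  | step {d n : ℤ} {x : HatSD0} {u : V} : n < 0 → x ∈ grade n → IsDescendant ρ T d u →
      IsDescendant ρ T (n + d) (ρ x u)

variable {V : Type*} [AddCommGroup V] [Module ℂ V] {ξ : Module.Dual ℂ (grade 0)}
  {ρ : HatSD0 →ₗ[ℂ] Module.End ℂ V} {𝒱 : ℤ → Submodule ℂ V} {v : V}

/-- The subspace of descendants of degree `d`. -/
def descendants (ρ : HatSD0 →ₗ[ℂ] Module.End ℂ V) (T : Submodule ℂ V) (d : ℤ) :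
    Submodule ℂ V where
  carrier := {u | IsDescendant ρ T d u}
  zero_mem' := .zero d
  add_mem' := .add
  smul_mem' c _ h := .smul c h

theorem IsDescendant.eq_zero {T : Submodule ℂ V} {d : ℤ} {u : V} (h : IsDescendant ρ T d u)
    (hd : 0 < d) : u = 0 := by
  induction h with
  | zero => rfl
  | add _ _ h1 h2 => rw [h1 hd, h2 hd, add_zero]
  | smul c _ h => rw [h hd, smul_zero]
  | base => exact absurd hd (lt_irrefl _)
  | step hn _ _ h => rw [h (by linarith), map_zero]

/-- Peels off the last lowering operator; this is what makes induction on the degree of descendants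
possible. -/
theorem IsDescendant.mem_of_step {T S : Submodule ℂ V} {d : ℤ} {u : V} (h : IsDescendant ρ T d u)
    (hT : T ≤ S)
    (hstep : ∀ n x w, n < 0 → x ∈ grade n → IsDescendant ρ T (d - n) w → ρ x w ∈ S) : u ∈ S := by
  induction h with
  | zero => exact zero_mem _
  | add _ _ h1 h2 => exact add_mem (h1 hstep) (h2 hstep)
  | smul c _ h => exact Submodule.smul_mem _ _ (h hstep)
  | base h => exact hT h
  | step hn hx h _ => exact hstep _ _ _ hn hx (by simpa using h)

theorem mem_of_mem_grade {W W' : Submodule ℂ V}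
    (h : ∀ (n : ℤ), ∀ x ∈ grade n, ∀ u ∈ W, ρ x u ∈ W') (x : HatSD0) {u : V} (hu : u ∈ W) :
    ρ x u ∈ W' := by
  have hx : x ∈ ⨆ n, grade n := iSup_grade ▸ Submodule.mem_top
  have : ⨆ n, grade n ≤ W'.comap (ρ.flip u) := iSup_le fun n x hx => h n x hx u hu
  exact this hx

namespace IsIrreducibleHighestWeight

/-! ### Commutation, descendants and irreducibility -/

/-- The value of the sign ε is irrelevant wherever only membership in a subspace is at stake. -/
theorem exists_comm (hV : IsIrreducibleHighestWeight ξ ρ 𝒱 v) {m n : ℤ} {x y : HatSD0}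
    (hx : x ∈ grade m) (hy : y ∈ grade n) :
    ∃ ε : ℂ, ∀ u, ρ x (ρ y u) = ε • ρ y (ρ x u) + ρ (bracket x y) u := by
  obtain ⟨p, hp⟩ := exists_parity m
  obtain ⟨q, hq⟩ := exists_parity n
  refine ⟨(-1 : ℂ) ^ (p.val * q.val), fun u => ?_⟩
  rw [hV.map_bracket p q x y (mem_parity_of_mem_grade hp hx) (mem_parity_of_mem_grade hq hy)]
  simp

theorem comm_odd (hV : IsIrreducibleHighestWeight ξ ρ 𝒱 v) {m n : ℤ} {x y : HatSD0}
    (hm : m % 2 = 1) (hn : n % 2 = 1) (hx : x ∈ grade m) (hy : y ∈ grade n) (u : V) :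
    ρ (bracket x y) u = ρ x (ρ y u) + ρ y (ρ x u) := by
  rw [hV.map_bracket 1 1 x y (mem_parity_of_mem_grade (by simpa using hm) hx)
    (mem_parity_of_mem_grade (by simpa using hn) hy)]
  simp

theorem bracket_apply_eq_zero (hV : IsIrreducibleHighestWeight ξ ρ 𝒱 v) {m n : ℤ} {x y : HatSD0}
    (hx : x ∈ grade m) (hy : y ∈ grade n) {c : ℂ} (hxv : ρ x v = c • v) (hyv : ρ y v = 0) :
    ρ (bracket x y) v = 0 := by
  obtain ⟨ε, h⟩ := hV.exists_comm hx hy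
  have := h v
  rw [hxv, hyv, map_zero, map_smul, hyv, smul_zero, smul_zero, zero_add] at this
  exact this.symm

/-- An operator x is moved to the right past each lowering operator y. The commutator is again
homogeneous and acts on a shorter descendant, so the induction must quantify over all weights j and
all x; no PBW basis is needed. -/
theorem isDescendant_apply (hV : IsIrreducibleHighestWeight ξ ρ 𝒱 v) {T : Submodule ℂ V}
    (h0 : ∀ x ∈ grade 0, ∀ u ∈ T, ρ x u ∈ T) (hpos : ∀ n > 0, ∀ x ∈ grade n, ∀ u ∈ T, ρ x u = 0)
    {j d : ℤ} {x : HatSD0} (hx : x ∈ grade j) {u : V} (hu : IsDescendant ρ T d u) :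
    IsDescendant ρ T (j + d) (ρ x u) := by
  induction hu generalizing j x with
  | zero => rw [map_zero]; exact .zero _
  | add _ _ h1 h2 => rw [map_add]; exact (h1 hx).add (h2 hx)
  | smul c _ h => rw [map_smul]; exact (h hx).smul c
  | base hu =>
    rcases lt_trichotomy j 0 with hj | rfl | hj
    · exact .step hj hx (.base hu)
    · exact .base (h0 x hx _ hu)
    · rw [hpos j hj x hx _ hu]; exact .zero _
  | @step d n y u hn hy _ h =>
    obtain ⟨ε, hε⟩ := hV.exists_comm hx hy
    rw [hε]
    refine .add (.smul _ ?_) ?_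
    · rw [show j + (n + d) = n + (j + d) by ring]
      exact .step hn hy (h hx)
    · rw [← add_assoc]
      exact h (bracket_mem_grade hx hy)

theorem iSup_descendants_stable (hV : IsIrreducibleHighestWeight ξ ρ 𝒱 v) {T : Submodule ℂ V}
    (h0 : ∀ x ∈ grade 0, ∀ u ∈ T, ρ x u ∈ T) (hpos : ∀ n > 0, ∀ x ∈ grade n, ∀ u ∈ T, ρ x u = 0)
    (x : HatSD0) (u : V) (hu : u ∈ ⨆ d, descendants ρ T d) :
    ρ x u ∈ ⨆ d, descendants ρ T d := by
  refine mem_of_mem_grade (fun j x hx u hu => ?_) x hu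
  have : ⨆ d, descendants ρ T d ≤ (⨆ d, descendants ρ T d).comap (ρ x) :=
    iSup_le fun d u hu => Submodule.mem_iSup_of_mem (j + d) (hV.isDescendant_apply h0 hpos hx hu)
  exact this hu

theorem descendants_le (hV : IsIrreducibleHighestWeight ξ ρ 𝒱 v) {T : Submodule ℂ V} {e : ℤ}
    (hT : T ≤ 𝒱 e) (d : ℤ) : descendants ρ T d ≤ 𝒱 (d + e) := by
  intro u hu
  have hu : IsDescendant ρ T d u := hu
  induction hu with
  | zero => exact zero_mem _
  | add _ _ h1 h2 => exact add_mem (h1 ‹_›) (h2 ‹_›)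
  | smul c _ h => exact Submodule.smul_mem _ _ (h ‹_›)
  | base h => rw [zero_add]; exact hT h
  | step hn hx _ h => rw [add_assoc]; exact hV.map_grade _ _ _ _ hx (h ‹_›)

/-- A family of subspaces of the components of an internal direct sum that spans the whole space
consists of the components. -/
theorem _root_.iSupIndep.le_of_iSup_eq_top {ι R M : Type*} [Ring R] [AddCommGroup M] [Module R M]
    {A B : ι → Submodule R M} (hB : iSupIndep B) (hAB : ∀ i, A i ≤ B i) (hA : ⨆ i, A i = ⊤)
    (i : ι) : B i ≤ A i := by
  have h1 : A i ⊔ ⨆ j ≠ i, B j = ⊤ := by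
    rw [eq_top_iff, ← hA]
    refine iSup_le fun j => ?_
    by_cases h : j = i
    · exact h ▸ le_sup_left
    · exact ((hAB j).trans (le_iSup₂_of_le j h le_rfl)).trans le_sup_right
  -- The modular law, available because A i ≤ B i: intersecting with B i removes the other summands
  -- by independence and leaves A i.
  have h2 : (A i ⊔ ⨆ j ≠ i, B j) ⊓ B i = A i ⊔ (⨆ j ≠ i, B j) ⊓ B i :=
    sup_inf_assoc_of_le _ (hAB i)
  rw [h1, top_inf_eq, inf_comm, (hB i).eq_bot, sup_bot_eq] at h2
  exact h2.le

/-- The descendants of T form a nonzero submodule, hence everything by irreducibility. Since they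
respect the grading, they fill each component separately. -/
theorem le_descendants (hV : IsIrreducibleHighestWeight ξ ρ 𝒱 v) {T : Submodule ℂ V}
    (h0 : ∀ x ∈ grade 0, ∀ u ∈ T, ρ x u ∈ T) (hpos : ∀ n > 0, ∀ x ∈ grade n, ∀ u ∈ T, ρ x u = 0)
    {e : ℤ} (hT : T ≤ 𝒱 e) (hne : T ≠ ⊥) (n : ℤ) : 𝒱 n ≤ descendants ρ T (n - e) := by
  have htop : ⨆ d, descendants ρ T d = ⊤ := by
    refine (hV.irreducible _ (hV.iSup_descendants_stable h0 hpos)).resolve_left fun h => hne ?_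
    rw [eq_bot_iff, ← h]
    exact fun u hu => Submodule.mem_iSup_of_mem 0 (IsDescendant.base hu)
  refine hV.isInternal.submodule_iSupIndep.le_of_iSup_eq_top
    (A := fun n => descendants ρ T (n - e)) (fun n => ?_) ?_ n
  · simpa using hV.descendants_le hT (n - e)
  · rw [← htop]
    exact (Equiv.subRight e).iSup_comp (g := fun d => descendants ρ T d)

/-- Singular vectors of negative weight vanish. -/
theorem singular_eq_zero (hV : IsIrreducibleHighestWeight ξ ρ 𝒱 v) {e : ℤ} (he : e < 0) {w : V}
    (hw : w ∈ 𝒱 e) (hpos : ∀ n > 0, ∀ x ∈ grade n, ρ x w = 0) : w = 0 := by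
  -- The whole space of singular vectors of this weight is used, not the line through w: w need not
  -- be a Cartan eigenvector, whereas T is stable under weight 0. Its nonzero descendants have
  -- weight at most e < 0, so they cannot reach v.
  let T : Submodule ℂ V :=
    𝒱 e ⊓ ⨅ n : {n : ℤ // 0 < n}, ⨅ x : grade n.1, LinearMap.ker (ρ x)
  have hmem : ∀ u, u ∈ T ↔ u ∈ 𝒱 e ∧ ∀ n > 0, ∀ x ∈ grade n, ρ x u = 0 := by
    intro u
    simp only [T, Submodule.mem_inf, Submodule.mem_iInf, LinearMap.mem_ker, Subtype.forall, gt_iff_lt]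
  by_contra hw0
  have hne : T ≠ ⊥ := fun h => hw0 (by
    have : w ∈ T := (hmem w).2 ⟨hw, hpos⟩
    rwa [h, Submodule.mem_bot] at this)
  have hle := hV.le_descendants (T := T) (e := e) (fun x hx u hu => ?_)
    (fun n hn x hx u hu => ((hmem u).1 hu).2 n hn x hx) inf_le_left hne 0
  · exact hV.ne_zero (IsDescendant.eq_zero (hle hV.mem_zero) (by linarith))
  · rw [hmem] at hu ⊢
    refine ⟨by simpa using hV.map_grade 0 e x u hx hu.1, fun n hn y hy => ?_⟩
    obtain ⟨ε, h⟩ := hV.exists_comm hy hx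
    rw [h, hu.2 n hn y hy, map_zero, smul_zero, zero_add]
    exact hu.2 n hn _ (by simpa using bracket_mem_grade hy hx)

/-- If every component of the Lie superalgebra applied to the highest weight vector yields a
finite-dimensional space, then the same holds for every vector. -/
theorem finiteDimensional_map_grade (hV : IsIrreducibleHighestWeight ξ ρ 𝒱 v)
    (h : ∀ n, FiniteDimensional ℂ ((grade n).map (ρ.flip v))) (u : V) (n : ℤ) :
    FiniteDimensional ℂ ((grade n).map (ρ.flip u)) := by
  -- The vectors with the desired property form a submodule: up to sign, z(yu) is y(zu) plus [z,
  -- y]u, so both contributions stay in finite-dimensional spaces. It contains v, hence is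
  -- everything.
  let W : Submodule ℂ V :=
    { carrier := {u | ∀ n, FiniteDimensional ℂ ((grade n).map (ρ.flip u))}
      zero_mem' := fun n => by
        rw [map_zero, Submodule.map_zero]
        infer_instance
      add_mem' := fun {a b} ha hb n => by
        have := ha n
        have := hb n
        exact Submodule.finiteDimensional_of_le
          (S₂ := (grade n).map (ρ.flip a) ⊔ (grade n).map (ρ.flip b))
          (by rw [map_add]; exact Submodule.map_add_le _ _ _)
      smul_mem' := fun c a ha n => by
        have := ha n
        refine Submodule.finiteDimensional_of_le (S₂ := (grade n).map (ρ.flip a)) ?_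
        rintro _ ⟨x, hx, rfl⟩
        exact ⟨c • x, Submodule.smul_mem _ _ hx, by simp⟩ }
  have hstable : ∀ x, ∀ u ∈ W, ρ x u ∈ W := by
    intro x u hu
    refine mem_of_mem_grade (W := W) (W' := W) (fun j y hy u hu n => ?_) x hu
    have := hu n
    have := hu (n + j)
    refine Submodule.finiteDimensional_of_le
      (S₂ := ((grade n).map (ρ.flip u)).map (ρ y) ⊔ (grade (n + j)).map (ρ.flip u)) ?_
    rintro _ ⟨z, hz, rfl⟩
    obtain ⟨ε, hε⟩ := hV.exists_comm hz hy
    rw [LinearMap.flip_apply, hε]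
    exact Submodule.add_mem_sup
      (Submodule.smul_mem _ _ (Submodule.mem_map_of_mem ⟨z, hz, rfl⟩))
      ⟨_, bracket_mem_grade hz hy, rfl⟩
  have hW : W = ⊤ := (hV.irreducible W hstable).resolve_left fun hbot => hV.ne_zero (by
    have : v ∈ W := h
    rwa [hbot, Submodule.mem_bot] at this)
  have hu : u ∈ W := hW ▸ Submodule.mem_top
  exact hu n

theorem isQuasifinite_of_finiteDimensional_map_grade (hV : IsIrreducibleHighestWeight ξ ρ 𝒱 v)
    (h : ∀ n, FiniteDimensional ℂ ((grade n).map (ρ.flip v))) : IsQuasifinite 𝒱 := by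
  have hmap := hV.finiteDimensional_map_grade h
  let T : Submodule ℂ V := Submodule.span ℂ {v}
  have hmap₂ : ∀ (n : ℤ) (N : Submodule ℂ V), FiniteDimensional ℂ N →
      FiniteDimensional ℂ (Submodule.map₂ ρ (grade n) N) := by
    intro n N hN
    refine Submodule.fg_induction
      (motive := fun N _ => FiniteDimensional ℂ (Submodule.map₂ ρ (grade n) N)) (fun u => ?_)
      (fun N₁ N₂ _ _ h₁ h₂ => ?_) N ((Submodule.fg_iff_finiteDimensional N).2 hN)
    · rw [Submodule.map₂_span_singleton_eq_map_flip]
      exact hmap u n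
    · rw [Submodule.map₂_sup_right]
      infer_instance
  -- Induction on a bound for the depth -d. Positive degrees give zero, and a descendant of degree d
  -- is a lowering operator of one of finitely many weights applied to a shallower descendant, or
  -- lies in T.
  have hdesc : ∀ (k : ℕ) (d : ℤ), -d < k → FiniteDimensional ℂ (descendants ρ T d) := by
    intro k
    induction k with
    | zero =>
      intro d hd
      have : descendants ρ T d = ⊥ :=
        eq_bot_iff.2 fun u hu => IsDescendant.eq_zero hu (by simpa using hd)
      rw [this]
      infer_instance
    | succ k ih =>
      intro d hd
      have hfin : ∀ j : ℕ, FiniteDimensional ℂ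
          (Submodule.map₂ ρ (grade (-(j + 1))) (descendants ρ T (d + (j + 1)))) :=
        fun j => hmap₂ _ _ (ih _ (by push_cast at hd; linarith))
      refine Submodule.finiteDimensional_of_le (S₂ := T ⊔ ⨆ j : Fin (k + 1),
        Submodule.map₂ ρ (grade (-((j : ℕ) + 1))) (descendants ρ T (d + ((j : ℕ) + 1)))) ?_
      intro u hu
      refine IsDescendant.mem_of_step hu le_sup_left fun n x w hn hx hw => ?_
      by_cases hd' : 0 < d - n
      · rw [hw.eq_zero hd', map_zero]
        exact zero_mem _
      · refine Submodule.mem_sup_right (Submodule.mem_iSup_of_mem ⟨(-n - 1).toNat, by omega⟩ ?_)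
        have e : ((-n - 1).toNat : ℤ) = -n - 1 := by omega
        refine Submodule.apply_mem_map₂ ρ ?_ ?_
        · simp only [e]
          rwa [show -(-n - 1 + 1) = n by ring]
        · change IsDescendant ρ T _ _
          simp only [e]
          rwa [show d + (-n - 1 + 1) = d - n by ring]
  intro n
  have := hdesc (n.natAbs + 1) n (by omega)
  refine Submodule.finiteDimensional_of_le (S₂ := descendants ρ T n) ?_
  have hT : ∀ u ∈ T, ∃ c : ℂ, c • v = u := fun u => Submodule.mem_span_singleton.1
  have := hV.le_descendants (T := T) (e := 0) ?_ ?_ ?_ ?_ n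
  · simpa using this
  · rintro x hx _ hu
    obtain ⟨c, rfl⟩ := hT _ hu
    rw [map_smul]
    have := hV.weight ⟨x, hx⟩
    simp only at this
    rw [this]
    exact Submodule.smul_mem _ _ (Submodule.smul_mem _ _ (Submodule.mem_span_singleton_self v))
  · rintro n hn x hx _ hu
    obtain ⟨c, rfl⟩ := hT _ hu
    rw [map_smul, hV.annihilated n hn x hx, smul_zero]
  · rw [Submodule.span_singleton_le_iff_mem]
    exact hV.mem_zero
  · rw [Ne, Submodule.span_singleton_eq_bot]
    exact hV.ne_zero

end IsIrreducibleHighestWeight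
end HatSD0

namespace SD

/-! ### Explicit brackets and cocycle values -/

theorem negShift_negShift (a : ℂ) (f : ℂ[X]) : negShift a (negShift a f) = f := by
  simp only [negShift, aeval_def, algebraMap_eq, ← comp.eq_1, comp_assoc]
  conv_rhs => rw [← comp_X (p := f)]
  congr 1
  simp

theorem eval_negShift (a b : ℂ) (f : ℂ[X]) : (negShift a f).eval b = f.eval (a - b) := by
  rw [negShift, aeval_def, algebraMap_eq, ← comp.eq_1, eval_comp]
  simp

theorem negShift_ne_zero (a : ℂ) {f : ℂ[X]} (hf : f ≠ 0) : negShift a f ≠ 0 := fun h =>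
  hf (by rw [← negShift_negShift a f, h, map_zero])

theorem bracket_el_skew_theta (a : ℤ) (f g : ℂ[X]) :
    bracket (el 1 0 a f) (skew (el 1 0 (-1) g))
      = el 1 1 a (f * negShift 0 g) + el 0 0 a (negShift (-a) g * f) := by
  have h : (skew (el 1 0 (-1) g) : SD) = el 1 0 (-1) g + el 0 1 0 (negShift 0 g) := by
    rw [coe_skew, sigma_el]; simp [zpow_neg, sub_eq_add_neg]
  rw [h, bracket_add_right, bracket_el, bracket_el, mul_el, mul_el, mul_el, mul_el]
  simp [taylor_negShift]

theorem coe_skew_el_X : (skew (el 0 0 0 X) : SD) = (2 : ℂ) • el 0 0 0 X := by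
  rw [coe_skew, sigma_el]
  simp [negShift, el_neg, two_smul]

theorem bracket_el_X_theta (m : ℤ) (f : ℂ[X]) :
    bracket (el 0 0 0 X) (el 1 0 m f) = (-1 : ℂ) • el 1 0 m (X * f) := by
  rw [bracket_el, mul_el, mul_el]
  simp [mul_comm]

theorem bracket_el_X_zero (r : ℤ) (f : ℂ[X]) :
    bracket (el 0 0 0 X) (el 0 0 r f) = (r : ℂ) • el 0 0 r f := by
  rw [bracket_el, mul_el, mul_el, ← el_smul, smul_eq_C_mul]
  simp only [↓reduceIte, zero_add, add_zero, taylor_X, Int.cast_zero, taylor_zero]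
  simp [← el_sub]
  ring_nf

theorem bracket_el_X_one (r : ℤ) (f : ℂ[X]) :
    bracket (el 0 0 0 X) (el 1 1 r f) = 0 := by
  rw [bracket_el, mul_el, mul_el]
  simp

/-- For f symmetric under D ↦ 1 - D, `skew` merely doubles the operator; and since ∂_θθ can multiply
θ only from the right, a single term survives. -/
theorem bracket_skew_el_theta (m : ℤ) {f : ℂ[X]} (hf : negShift 1 f = f) (g : ℂ[X]) :
    bracket (skew (el 0 0 (-1) f)) (el 1 0 m g)
      = -(2 : ℂ) • el 1 0 (m - 1) (taylor (-1) g * f) := by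
  have h : (skew (el 0 0 (-1) f) : SD) = (2 : ℂ) • el 0 0 (-1) f := by
    rw [coe_skew, sigma_el]; simp [zpow_neg, hf, two_smul]
  rw [h, bracket_smul_left, bracket_el, mul_el, mul_el]
  simp [sub_eq_add_neg]

/-- Of the four pairings only that of t ∂_θ with t⁻¹ θ contributes, through the single index j = -1;
the pairing in t⁰ has an empty sum. -/
theorem cocycle_skew_theta (f g : ℂ[X]) :
    cocycle (skew (el 1 0 0 f)) (skew (el 1 0 (-1) g)) = -(f * negShift 0 g).eval 0 := by
  have hf : (skew (el 1 0 0 f) : SD) = el 1 0 0 f + el 0 1 1 (-negShift (-1) f) := by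
    rw [coe_skew, sigma_el, el_neg]; simp [sub_eq_add_neg]
  have hg : (skew (el 1 0 (-1) g) : SD) = el 1 0 (-1) g + el 0 1 0 (negShift 0 g) := by
    rw [coe_skew, sigma_el]; simp [zpow_neg, sub_eq_add_neg]
  have hI : Finset.Ico (-1 : ℤ) 0 = {-1} := rfl
  rw [hf, hg, cocycle_add_left, cocycle_add_right, cocycle_add_right, cocycle_el_of_ne,
    cocycle_el_of_ne, cocycle_el_of_ne (i := 0) (m := 1), cocycle_el, cocycleTerm]
  · simp [hI, strEval, Matrix.mul_apply, Matrix.single_apply, Fin.sum_univ_two,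
      eval_negShift]
  all_goals simp

end SD

namespace HatSD0

open SD

theorem bracket_hatSkew_X {n : ℤ} (hn : n ≠ 0) {B : SD} (hB : B ∈ homog n) :
    bracket (hatSkew (el 0 0 0 X)) (hatSkew B)
      = (2 : ℂ) • hatSkew (SD.bracket (el 0 0 0 X) B) := by
  rw [bracket_hatSkew_right, cocycle_eq_zero (m := 0) (n := n) (by simpa using hn)
    (hatSkew_el_mem_grade (i := 0) (k := 0) (r := 0) (by simp) X).1 (hatSkew_mem_grade hB).1,
    zero_smul, add_zero, hatSkew_apply (el 0 0 0 X), coe_skew_el_X, bracket_smul_left, map_smul]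

/-- The bracket of the elements of weight `1 / 2` and `-1 / 2` with symbols `f` and `g`, as a
function of `h = f(D) g(-D)`. -/
def cartan : ℂ[X] →ₗ[ℂ] grade 0 :=
  (hatSkew ∘ₗ (elₗ 1 1 0 + elₗ 0 0 0)
    + LinearMap.smulRight (-Polynomial.leval (0 : ℂ)) (central : HatSD0)).codRestrict (grade 0) fun h => by
      rw [LinearMap.add_apply, LinearMap.comp_apply, LinearMap.add_apply, map_add]
      exact add_mem (add_mem (hatSkew_el_mem_grade (by simp) _) (hatSkew_el_mem_grade (by simp) _))
        (Submodule.smul_mem _ _ central.2)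

theorem coe_cartan (h : ℂ[X]) : (cartan h : HatSD0)
    = hatSkew (el 1 1 0 h + el 0 0 0 h) + (-h.eval 0) • (central : HatSD0) := rfl

theorem bracket_theta_theta (f g : ℂ[X]) :
    bracket (hatSkew (el 1 0 0 f)) (hatSkew (el 1 0 (-1) g)) = cartan (f * negShift 0 g) := by
  rw [bracket_hatSkew_left, coe_cartan]
  congr 2
  · rw [hatSkew_apply, bracket_el_skew_theta]
    simp [mul_comm]
  · exact cocycle_skew_theta f g

/-- Makes the ∂_θ-type elements redundant: each is a θ-type element of the same weight. -/
theorem hatSkew_el_zero_one (r : ℤ) (f : ℂ[X]) :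
    hatSkew (el 0 1 r f) = (-1 : ℂ) ^ r • hatSkew (el 1 0 (r - 1) (negShift (-r) f)) := by
  have h := hatSkew_sigma (el 0 1 r f)
  rw [sigma_el, map_smul] at h
  have h' := congrArg (fun x => (-1 : ℂ) • x) h
  simp only [smul_smul] at h'
  rw [show (-1 : ℂ) * -1 = 1 by norm_num, one_smul] at h'
  rw [← h']
  simp

/-- A linear map on polynomials that vanishes on a nonzero ideal has finite-dimensional range. -/
theorem _root_.LinearMap.finiteDimensional_range_of_forall_mul {K M : Type*} [Field K]
    [AddCommGroup M] [Module K M] (L : K[X] →ₗ[K] M) {α : K[X]} (hα : α ≠ 0)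
    (h : ∀ g, L (g * α) = 0) : FiniteDimensional K (LinearMap.range L) := by
  have : FiniteDimensional K (degreeLT K α.natDegree) :=
    Module.Finite.equiv (degreeLTEquiv K α.natDegree).symm
  refine Submodule.finiteDimensional_of_le (S₂ := (degreeLT K α.natDegree).map L) ?_
  rintro _ ⟨f, rfl⟩
  refine ⟨f % α, ?_, ?_⟩
  · rw [SetLike.mem_coe, mem_degreeLT, ← degree_eq_natDegree hα]
    exact EuclideanDomain.mod_lt f hα
  · conv_rhs => rw [← EuclideanDomain.mod_add_div f α, map_add, mul_comm α, h, add_zero]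

variable {V : Type*} [AddCommGroup V] [Module ℂ V] {ξ : Module.Dual ℂ (grade 0)}
  {ρ : HatSD0 →ₗ[ℂ] Module.End ℂ V} {𝒱 : ℤ → Submodule ℂ V} {v : V}

namespace IsIrreducibleHighestWeight

/-! ### Spreading one relation to all negative weights -/

theorem bracket_X_apply_eq_zero (hV : IsIrreducibleHighestWeight ξ ρ 𝒱 v) {n : ℤ} (hn : n ≠ 0)
    {B : SD} (hB : B ∈ homog n) (h : ρ (hatSkew B) v = 0) :
    ρ (hatSkew (SD.bracket (el 0 0 0 X) B)) v = 0 := by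
  have hX : hatSkew (el 0 0 0 X) ∈ grade 0 := hatSkew_el_mem_grade (by simp) X
  have := hV.bracket_apply_eq_zero hX (hatSkew_mem_grade hB) (hV.weight ⟨_, hX⟩) h
  rw [bracket_hatSkew_X hn hB, map_smul, LinearMap.smul_apply] at this
  exact (smul_eq_zero.1 this).resolve_left two_ne_zero

/-- Bracketing with D ∂_θθ, which acts on v by a scalar, multiplies the θ-symbol by -D; so the
annihilating symbols form an ideal. -/
theorem theta_mul_apply_eq_zero (hV : IsIrreducibleHighestWeight ξ ρ 𝒱 v) {m : ℤ} {f : ℂ[X]}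
    (hf : ρ (hatSkew (el 1 0 m f)) v = 0) (g : ℂ[X]) :
    ρ (hatSkew (el 1 0 m (g * f))) v = 0 := by
  induction g using Polynomial.induction_on' with
  | add p q hp hq => rw [add_mul, el_add, map_add, map_add, LinearMap.add_apply, hp, hq, add_zero]
  | monomial n a =>
    rw [← C_mul_X_pow_eq_monomial, mul_assoc, ← smul_eq_C_mul, el_smul, map_smul, map_smul,
      LinearMap.smul_apply]
    suffices ρ (hatSkew (el 1 0 m (X ^ n * f))) v = 0 by rw [this, smul_zero]
    induction n with
    | zero => simpa using hf
    | succ n ih =>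
      have := hV.bracket_X_apply_eq_zero (by simp; omega) (el_mem_homog 1 0 m _) ih
      rw [bracket_el_X_theta, map_smul, map_smul, LinearMap.smul_apply, ← mul_assoc,
        ← pow_succ'] at this
      exact (smul_eq_zero.1 this).resolve_left (by norm_num)

theorem diag_apply_eq_zero (hV : IsIrreducibleHighestWeight ξ ρ 𝒱 v) {m : ℤ} (hm : m ≠ 0)
    {f g : ℂ[X]} (hf : ρ (hatSkew (el 1 0 m f)) v = 0) (hg : ρ (hatSkew (el 1 0 (-1) g)) v = 0) :
    ρ (hatSkew (el 1 1 m (f * negShift 0 g))) v = 0 ∧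
      ρ (hatSkew (el 0 0 m (negShift (-m) g * f))) v = 0 := by
  have hf' : el 1 0 m f ∈ homog (2 * m + 1) := by simpa using el_mem_homog 1 0 m f
  have hg' : el 1 0 (-1) g ∈ homog (-1) := by simpa using el_mem_homog 1 0 (-1) g
  have h1 := hV.bracket_apply_eq_zero (c := 0) (hatSkew_mem_grade hf') (hatSkew_mem_grade hg')
    (by rw [hf, zero_smul]) hg
  rw [bracket_hatSkew_left, cocycle_eq_zero (by omega) (hatSkew_mem_grade hf').1
    (hatSkew_mem_grade hg').1, zero_smul, add_zero, hatSkew_apply (el 1 0 (-1) g),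
    bracket_el_skew_theta] at h1
  have h11 : el 1 1 m (f * negShift 0 g) ∈ homog (2 * m) := by
    simpa using el_mem_homog 1 1 m (f * negShift 0 g)
  have h00 : el 0 0 m (negShift (-m) g * f) ∈ homog (2 * m) := by
    simpa using el_mem_homog 0 0 m (negShift (-m) g * f)
  -- The bracket of two θ-type annihilators gives only the sum of two diagonal terms. Bracketing
  -- with D ∂_θθ kills the θ∂_θ term and scales the other by m ≠ 0, which separates them.
  have h2 := hV.bracket_X_apply_eq_zero (n := 2 * m) (by omega) (add_mem h11 h00) h1
  rw [bracket_add_right, bracket_el_X_one, bracket_el_X_zero, zero_add, map_smul, map_smul,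
    LinearMap.smul_apply] at h2
  have h3 := (smul_eq_zero.1 h2).resolve_left (Int.cast_ne_zero.2 hm)
  rw [map_add, map_add, LinearMap.add_apply, h3, add_zero] at h1
  exact ⟨h1, h3⟩

/-- Bracketing y_g with itself yields the annihilator with symbol g(1 - D) g(D) in t⁻¹ ∂_θθ. This
symbol is symmetric under D ↦ 1 - D, so its bracket with a θ-type annihilator is again of θ-type,
one power of t lower. -/
theorem theta_pred_apply_eq_zero (hV : IsIrreducibleHighestWeight ξ ρ 𝒱 v) {m : ℤ} (hm : m < 0)
    {f g : ℂ[X]} (hf : ρ (hatSkew (el 1 0 m f)) v = 0) (hg : ρ (hatSkew (el 1 0 (-1) g)) v = 0) :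
    ρ (hatSkew (el 1 0 (m - 1) (taylor (-1) f * (negShift 1 g * g)))) v = 0 := by
  have h0 := (hV.diag_apply_eq_zero (by norm_num) hg hg).2
  rw [show -((-1 : ℤ) : ℂ) = 1 by norm_num] at h0
  have h00 : el 0 0 (-1) (negShift 1 g * g) ∈ homog (-2) := by
    simpa using el_mem_homog 0 0 (-1) (negShift 1 g * g)
  have hf' : el 1 0 m f ∈ homog (2 * m + 1) := by simpa using el_mem_homog 1 0 m f
  have h1 := hV.bracket_apply_eq_zero (c := 0) (hatSkew_mem_grade h00) (hatSkew_mem_grade hf')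
    (by rw [h0, zero_smul]) hf
  rw [bracket_hatSkew_right, cocycle_eq_zero (by omega) (hatSkew_mem_grade h00).1
    (hatSkew_mem_grade hf').1, zero_smul, add_zero, hatSkew_apply (el 0 0 (-1) _),
    bracket_skew_el_theta m (by rw [map_mul, negShift_negShift, mul_comm]), map_smul, map_smul,
    LinearMap.smul_apply] at h1
  exact (smul_eq_zero.1 h1).resolve_left (by norm_num)

theorem exists_theta_apply_eq_zero (hV : IsIrreducibleHighestWeight ξ ρ 𝒱 v) {α : ℂ[X]}
    (hα : α ≠ 0) (h : ρ (hatSkew (el 1 0 (-1) α)) v = 0) {m : ℤ} (hm : m ≤ -1) :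
    ∃ f : ℂ[X], f ≠ 0 ∧ ρ (hatSkew (el 1 0 m f)) v = 0 := by
  induction m, hm using Int.leInductionDown with
  | base => exact ⟨α, hα, h⟩
  | pred m hm ih =>
    obtain ⟨f, hf, hfv⟩ := ih
    exact ⟨_, mul_ne_zero ((map_ne_zero_iff _ (taylor_injective _)).2 hf)
      (mul_ne_zero (negShift_ne_zero 1 hα) hα), hV.theta_pred_apply_eq_zero (by omega) hfv h⟩

/-- The map `f ↦ (t ^ r f(D) M_{ik} - σ(t ^ r f(D) M_{ik})) v`. -/
def symbolMap (ρ : HatSD0 →ₗ[ℂ] Module.End ℂ V) (v : V) (i k : Fin 2) (r : ℤ) : ℂ[X] →ₗ[ℂ] V :=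
  ρ.flip v ∘ₗ hatSkew ∘ₗ elₗ i k r

theorem finiteDimensional_range_symbolMap (hV : IsIrreducibleHighestWeight ξ ρ 𝒱 v) {α : ℂ[X]}
    (hα : α ≠ 0) (h : ρ (hatSkew (el 1 0 (-1) α)) v = 0) {i k : Fin 2} {r : ℤ}
    (hr : 2 * r + i.val - k.val < 0) :
    FiniteDimensional ℂ (LinearMap.range (symbolMap ρ v i k r)) := by
  have h10 : ∀ m : ℤ, m ≤ -1 → FiniteDimensional ℂ (LinearMap.range (symbolMap ρ v 1 0 m)) := by
    intro m hm
    obtain ⟨f, hf, hfv⟩ := hV.exists_theta_apply_eq_zero hα h hm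
    exact LinearMap.finiteDimensional_range_of_forall_mul _ hf (hV.theta_mul_apply_eq_zero hfv)
  have hcases : ∀ a : Fin 2, a = 0 ∨ a = 1 := by decide
  rcases hcases i with rfl | rfl <;> rcases hcases k with rfl | rfl <;>
    simp only [Fin.val_zero, Fin.val_one, Nat.cast_zero, Nat.cast_one] at hr
  · obtain ⟨f, hf, hfv⟩ := hV.exists_theta_apply_eq_zero hα h (m := r) (by omega)
    refine LinearMap.finiteDimensional_range_of_forall_mul _
      (mul_ne_zero (negShift_ne_zero (-r) hα) hf) fun g => ?_
    rw [mul_left_comm]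
    exact (hV.diag_apply_eq_zero (by omega) (hV.theta_mul_apply_eq_zero hfv g) h).2
  · have := h10 (r - 1) (by omega)
    refine Submodule.finiteDimensional_of_le (S₂ := LinearMap.range (symbolMap ρ v 1 0 (r - 1))) ?_
    rintro _ ⟨f, rfl⟩
    refine ⟨(-1 : ℂ) ^ r • negShift (-r) f, ?_⟩
    simp only [symbolMap, LinearMap.comp_apply, map_smul, elₗ_apply, hatSkew_el_zero_one]
  · exact h10 r (by omega)
  · obtain ⟨f, hf, hfv⟩ := hV.exists_theta_apply_eq_zero hα h (m := r) (by omega)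
    refine LinearMap.finiteDimensional_range_of_forall_mul _
      (mul_ne_zero hf (negShift_ne_zero 0 hα)) fun g => ?_
    rw [← mul_assoc]
    exact (hV.diag_apply_eq_zero (by omega) (hV.theta_mul_apply_eq_zero hfv g) h).1

theorem isQuasifinite_of_theta_apply_eq_zero (hV : IsIrreducibleHighestWeight ξ ρ 𝒱 v) {α : ℂ[X]}
    (hα : α ≠ 0) (h : ρ (hatSkew (el 1 0 (-1) α)) v = 0) : IsQuasifinite 𝒱 := by
  refine hV.isQuasifinite_of_finiteDimensional_map_grade fun n => ?_
  rcases lt_or_ge n 0 with hn | hn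
  -- When the parity of n does not match i - k, the division rounds down; the resulting weight is
  -- still negative, so the extra summand is harmless.
  · have := fun i k : Fin 2 => hV.finiteDimensional_range_symbolMap hα h (i := i) (k := k)
      (r := (n - i.val + k.val) / 2) (by omega)
    refine Submodule.finiteDimensional_of_le (S₂ := ⨆ i : Fin 2, ⨆ k : Fin 2,
      LinearMap.range (symbolMap ρ v i k ((n - i.val + k.val) / 2))) ?_
    rintro _ ⟨x, hx, rfl⟩
    refine grade_induction (motive := fun x => ρ.flip v x ∈ _) hn.ne ?_ (fun x y hx hy => ?_)
      (fun i k r f hr => ?_) hx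
    · rw [map_zero]; exact zero_mem _
    · rw [map_add]; exact add_mem hx hy
    · have hr' : (n - i.val + k.val) / 2 = r := by omega
      exact Submodule.mem_iSup_of_mem i (Submodule.mem_iSup_of_mem k (hr' ▸ ⟨f, rfl⟩))
  · refine Submodule.finiteDimensional_of_le (S₂ := Submodule.span ℂ {v}) ?_
    rintro _ ⟨x, hx, rfl⟩
    rw [LinearMap.flip_apply]
    rcases hn.eq_or_lt with rfl | hn
    · exact Submodule.mem_span_singleton.2 ⟨_, (hV.weight ⟨x, hx⟩).symm⟩
    · rw [hV.annihilated n hn x hx]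
      exact zero_mem _

/-! ### The criterion in weight -1/2 -/

theorem cartan_apply (hV : IsIrreducibleHighestWeight ξ ρ 𝒱 v) (f g : ℂ[X]) :
    ρ (hatSkew (el 1 0 0 f)) (ρ (hatSkew (el 1 0 (-1) g)) v)
      = ξ (cartan (f * negShift 0 g)) • v := by
  have h1 : hatSkew (el 1 0 0 f) ∈ grade 1 := hatSkew_el_mem_grade (by simp) f
  have h2 : hatSkew (el 1 0 (-1) g) ∈ grade (-1) := hatSkew_el_mem_grade (by simp) g
  have := hV.comm_odd (by norm_num) (by norm_num) h1 h2 v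
  rw [bracket_theta_theta, hV.weight, hV.annihilated 1 one_pos _ h1, map_zero, add_zero] at this
  exact this.symm

theorem theta_apply_eq_zero_iff (hV : IsIrreducibleHighestWeight ξ ρ 𝒱 v) (α : ℂ[X]) :
    ρ (hatSkew (el 1 0 (-1) α)) v = 0 ↔ ∀ g, ξ (cartan (g * negShift 0 α)) = 0 := by
  refine ⟨fun h g => ?_, fun h => ?_⟩
  · have := hV.cartan_apply g α
    rw [h, map_zero] at this
    exact (smul_eq_zero.1 this.symm).resolve_right hV.ne_zero
  · have hm : hatSkew (el 1 0 (-1) α) ∈ grade (-1) := hatSkew_el_mem_grade (by simp) α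
    have hw : ρ (hatSkew (el 1 0 (-1) α)) v ∈ 𝒱 (-1) := hV.map_grade (-1) 0 _ _ hm hV.mem_zero
    refine hV.singular_eq_zero (by norm_num) hw fun n hn x hx => ?_
    -- Only weight 1/2 imposes a condition: from weight 1 upwards, the commutator with the lowering
    -- operator still has positive weight and kills v.
    rcases (show 1 ≤ n from hn).eq_or_lt with rfl | hn
    · refine grade_induction (motive := fun x => ρ x (ρ _ v) = 0) one_ne_zero (by simp)
        (fun x y hx hy => by rw [map_add, LinearMap.add_apply, hx, hy, add_zero])
        (fun i k r f hr => ?_) hx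
      have h10 : ∀ g, ρ (hatSkew (el 1 0 0 g)) (ρ (hatSkew (el 1 0 (-1) α)) v) = 0 := fun g => by
        rw [hV.cartan_apply, h, zero_smul]
      have hcases : ∀ a : Fin 2, a = 0 ∨ a = 1 := by decide
      rcases hcases i with rfl | rfl <;> rcases hcases k with rfl | rfl <;>
        simp only [Fin.val_zero, Fin.val_one, Nat.cast_zero, Nat.cast_one] at hr
      · omega
      · obtain rfl : r = 1 := by omega
        rw [hatSkew_el_zero_one, map_smul, LinearMap.smul_apply, sub_self, h10, smul_zero]
      · obtain rfl : r = 0 := by omega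
        exact h10 f
      · omega
    · obtain ⟨ε, hε⟩ := hV.exists_comm hx hm
      rw [hε, hV.annihilated n (by omega) x hx, map_zero, smul_zero, zero_add]
      exact hV.annihilated (n + -1) (by omega) _ (bracket_mem_grade hx hm)

theorem exists_theta_apply_eq_zero_of_isQuasifinite (hV : IsIrreducibleHighestWeight ξ ρ 𝒱 v)
    (hfin : IsQuasifinite 𝒱) : ∃ α : ℂ[X], α ≠ 0 ∧ ρ (hatSkew (el 1 0 (-1) α)) v = 0 := by
  have := hfin (-1)
  let L : ℂ[X] →ₗ[ℂ] 𝒱 (-1) := (symbolMap ρ v 1 0 (-1)).codRestrict (𝒱 (-1)) fun f =>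
    hV.map_grade (-1) 0 (hatSkew (el 1 0 (-1) f)) v (hatSkew_el_mem_grade (by simp) f) hV.mem_zero
  have hL : ¬Function.Injective L := fun hinj =>
    Polynomial.not_finite (R := ℂ) (Module.Finite.of_injective L hinj)
  rw [← LinearMap.ker_eq_bot, Submodule.eq_bot_iff] at hL
  push Not at hL
  obtain ⟨α, hα, hne⟩ := hL
  exact ⟨α, hne, congrArg Subtype.val hα⟩

theorem isQuasifinite_iff_exists (hV : IsIrreducibleHighestWeight ξ ρ 𝒱 v) :
    IsQuasifinite 𝒱 ↔ ∃ α : ℂ[X], α ≠ 0 ∧ ∀ g, ξ (cartan (g * negShift 0 α)) = 0 := by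
  simp only [← hV.theta_apply_eq_zero_iff]
  exact ⟨hV.exists_theta_apply_eq_zero_of_isQuasifinite,
    fun ⟨_, hα, h⟩ => hV.isQuasifinite_of_theta_apply_eq_zero hα h⟩

end IsIrreducibleHighestWeight

/-! ### The generating function -/

theorem hatSkew_el_zero_neg_X_pow (n : ℕ) :
    hatSkew (el 0 0 0 ((-X) ^ n)) = (-2 : ℂ) • (sinh₀ n : HatSD0) := by
  apply Prod.ext
  · apply Subtype.ext
    change (skew (el 0 0 0 ((-X) ^ n)) : SD) = (-2 : ℂ) • el 0 0 0 (C (1 / 2) * (X ^ n - (-X) ^ n))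
    rw [coe_skew, sigma_el, ← el_smul 0 0 0 (-2), smul_eq_C_mul, ← mul_assoc, ← C_mul]
    simp [negShift, ← el_sub]
  · simp [hatSkew_apply, sinh₀]

theorem hatSkew_el_one_neg_pow (n : ℕ) :
    hatSkew (el 1 1 0 ((-(X + C (1 / 2))) ^ n)) = (-2 : ℂ) • (sinh₁ n : HatSD0) := by
  apply Prod.ext
  · apply Subtype.ext
    change (skew (el 1 1 0 ((-(X + C (1 / 2))) ^ n)) : SD)
      = (-2 : ℂ) • el 1 1 0 (C (1 / 2) * ((X + C (1 / 2)) ^ n - (-(X + C (1 / 2))) ^ n))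
    have e : negShift (-1) (-(X + C (1 / 2))) = X + C (1 / 2) := by
      simp only [negShift, map_neg, map_add, aeval_X, aeval_C, algebraMap_eq]
      have : (C (-1) : ℂ[X]) = -C (1 / 2) - C (1 / 2) := by
        rw [← C_neg, ← C_sub]; norm_num
      rw [← C_neg, this]; ring
    rw [coe_skew, sigma_el, ← el_smul 1 1 0 (-2), smul_eq_C_mul, ← mul_assoc, ← C_mul]
    simp only [Fin.val_one, Nat.cast_one, Int.cast_zero, neg_zero, zero_sub, map_pow, e]
    simp [← el_sub]
  · simp [hatSkew_apply, sinh₁]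

/-- On θ∂_θ the anti-involution reflects D about -1/2, so powers must be recentred there. The shift
by 1/2 produces the binomial convolution that becomes the factor e^{x/2}. -/
theorem neg_X_pow_eq_sum (n : ℕ) : (-X : ℂ[X]) ^ n
    = ∑ k ∈ Finset.range (n + 1), ((1 / 2) ^ (n - k) * (n.choose k : ℂ)) •
      (-(X + C (1 / 2))) ^ k := by
  have h : (-X : ℂ[X]) = -(X + C (1 / 2)) + C (1 / 2) := by ring
  rw [h, add_pow]
  refine Finset.sum_congr rfl fun k _ => ?_
  rw [smul_eq_C_mul, C_mul, C_pow, C_eq_natCast]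
  ring

theorem cartan_neg_X_pow (n : ℕ) : cartan ((-X) ^ n)
    = ∑ k ∈ Finset.range (n + 1), ((1 / 2) ^ (n - k) * (n.choose k : ℂ)) • (-2 : ℂ) • sinh₁ k
      + (-2 : ℂ) • sinh₀ n + (-(0 : ℂ) ^ n) • central := by
  apply Subtype.ext
  rw [coe_cartan, map_add, hatSkew_el_zero_neg_X_pow]
  have h : hatSkew (el 1 1 0 ((-X) ^ n)) = ((∑ k ∈ Finset.range (n + 1),
      ((1 / 2) ^ (n - k) * (n.choose k : ℂ)) • (-2 : ℂ) • sinh₁ k : grade 0) : HatSD0) := by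
    rw [neg_X_pow_eq_sum, ← elₗ_apply, map_sum, map_sum, Submodule.coe_sum]
    refine Finset.sum_congr rfl fun k _ => ?_
    rw [map_smul, map_smul, elₗ_apply, hatSkew_el_one_neg_pow]
    rfl
  rw [h]
  simp

theorem coeff_expHalf (n : ℕ) : PowerSeries.coeff n expHalf = (1 / 2) ^ n / n.factorial := by
  simp [expHalf, PowerSeries.coeff_rescale, PowerSeries.coeff_exp, div_eq_mul_inv]

theorem factorial_mul_coeff_mul_expHalf (ξ : Module.Dual ℂ (grade 0)) (n : ℕ) :
    (n.factorial : ℂ) * PowerSeries.coeff n (Delta₁ ξ * expHalf)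
      = ∑ k ∈ Finset.range (n + 1), ((1 / 2) ^ (n - k) * (n.choose k : ℂ)) * -ξ (sinh₁ k) := by
  rw [PowerSeries.coeff_mul, Finset.Nat.sum_antidiagonal_eq_sum_range_succ_mk, Finset.mul_sum]
  refine Finset.sum_congr rfl fun k hk => ?_
  rw [coeff_expHalf, Delta₁, PowerSeries.coeff_mk,
    Nat.cast_choose ℂ (Nat.le_of_lt_succ (Finset.mem_range.1 hk))]
  ring

theorem two_mul_factorial_mul_coeff (ξ : Module.Dual ℂ (grade 0)) (n : ℕ) :
    2 * ((n.factorial : ℂ) * PowerSeries.coeff n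
      (Delta₀ ξ + Delta₁ ξ * expHalf - PowerSeries.C (ξ central / 2))) = ξ (cartan ((-X) ^ n)) := by
  have h0 : (n.factorial : ℂ) * PowerSeries.coeff n (Delta₀ ξ) = -ξ (sinh₀ n) := by
    rw [Delta₀, PowerSeries.coeff_mk, mul_div_cancel₀ _ (Nat.cast_ne_zero.2 n.factorial_ne_zero)]
  have hc : 2 * ((n.factorial : ℂ) * PowerSeries.coeff n (PowerSeries.C (ξ central / 2)))
      = 0 ^ n * ξ central := by
    rw [PowerSeries.coeff_C]
    split_ifs with hn
    · subst hn; simp; ring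
    · simp [hn]
  rw [map_sub, map_add, mul_sub, mul_add, mul_sub, mul_add, h0, hc,
    factorial_mul_coeff_mul_expHalf, cartan_neg_X_pow]
  simp only [map_add, map_sum, map_smul, smul_eq_mul, neg_mul, sub_eq_add_neg, Finset.mul_sum]
  rw [add_comm (2 * _)]
  congr 2
  · exact Finset.sum_congr rfl fun k _ => by ring
  · ring

/-! ### Constant-coefficient operators and moment functionals -/

theorem factorial_mul_coeff_derivative_pow (F : PowerSeries ℂ) (k n : ℕ) :
    (n.factorial : ℂ) * PowerSeries.coeff n
        ((((PowerSeries.derivative ℂ : Derivation ℂ (PowerSeries ℂ) (PowerSeries ℂ)) :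
          PowerSeries ℂ →ₗ[ℂ] PowerSeries ℂ) ^ k) F)
      = ((n + k).factorial : ℂ) * PowerSeries.coeff (n + k) F := by
  induction k generalizing n with
  | zero => simp
  | succ k ih =>
    rw [pow_succ', Module.End.mul_apply, Derivation.coeFn_coe, PowerSeries.coeff_derivative,
      show n + (k + 1) = n + 1 + k by ring, ← ih, Nat.factorial_succ]
    push_cast
    ring

/-- The functional φ records the numbers n! a_n of a series. Differentiation shifts this sequence by
one, which is multiplication by X in the argument of φ. -/
theorem factorial_mul_coeff_diffOp (α : ℂ[X]) (F : PowerSeries ℂ) (φ : ℂ[X] →ₗ[ℂ] ℂ)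
    (hφ : ∀ n, (n.factorial : ℂ) * PowerSeries.coeff n F = φ (X ^ n)) (n : ℕ) :
    (n.factorial : ℂ) * PowerSeries.coeff n (diffOp α F) = φ (X ^ n * α) := by
  rw [diffOp]
  induction α using Polynomial.induction_on' with
  | add p q hp hq => rw [map_add, LinearMap.add_apply, map_add, mul_add, hp, hq, mul_add, map_add]
  | monomial k a =>
    rw [← C_mul_X_pow_eq_monomial, ← smul_eq_C_mul, map_smul, map_pow, aeval_X,
      LinearMap.smul_apply, map_smul, mul_smul_comm, mul_smul_comm, map_smul,
      factorial_mul_coeff_derivative_pow, hφ, pow_add]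

theorem diffOp_eq_zero_iff (ξ : Module.Dual ℂ (grade 0)) (α : ℂ[X]) :
    diffOp α (Delta₀ ξ + Delta₁ ξ * expHalf - PowerSeries.C (ξ central / 2)) = 0 ↔
      ∀ g, ξ (cartan (g * negShift 0 α)) = 0 := by
  have key := factorial_mul_coeff_diffOp α
    (Delta₀ ξ + Delta₁ ξ * expHalf - PowerSeries.C (ξ central / 2))
    -- The reflection w ↦ -w turns X^n into (-X)^n, whose `cartan` value gives the n-th coefficient;
    -- 2⁻¹ cancels the factor 2 coming from A - σ(A).
    ((2⁻¹ : ℂ) • (ξ ∘ₗ cartan ∘ₗ (negShift 0).toLinearMap)) fun n => by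
      have h : negShift 0 (X ^ n) = (-X) ^ n := by simp [negShift]
      simp only [LinearMap.smul_apply, LinearMap.comp_apply, AlgHom.toLinearMap_apply, h,
        ← two_mul_factorial_mul_coeff, smul_eq_mul]
      rw [inv_mul_cancel_left₀ two_ne_zero]
  have hfac : ∀ n : ℕ, (n.factorial : ℂ) ≠ 0 := fun n => Nat.cast_ne_zero.2 n.factorial_ne_zero
  simp only [LinearMap.smul_apply, LinearMap.comp_apply, AlgHom.toLinearMap_apply, map_mul] at key
  constructor
  · intro h g
    -- Reflecting g puts the argument in the form g'(-w) α(-w), so linearity in g' reduces the claim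
    -- to the monomials covered by `key`.
    rw [← negShift_negShift 0 g]
    induction negShift 0 g using Polynomial.induction_on' with
    | add p q hp hq => rw [map_add, add_mul, map_add, map_add, hp, hq, add_zero]
    | monomial k a =>
      have hk := key k
      rw [h, map_zero, mul_zero, eq_comm, smul_eq_zero] at hk
      rw [← C_mul_X_pow_eq_monomial, ← smul_eq_C_mul, map_smul, smul_mul_assoc, map_smul, map_smul,
        hk.resolve_left (by norm_num), smul_zero]
  · intro h
    ext n
    have hn := key n
    rw [h, smul_zero] at hn
    rw [map_zero]
    exact (mul_eq_zero.1 hn).resolve_left (hfac n)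

end HatSD0

end SuperCircle

end

theorem mainTheorem2 {V : Type*} [AddCommGroup V] [Module ℂ V]
    (ξ : Module.Dual ℂ (SuperCircle.HatSD0.grade 0))
    (ρ : SuperCircle.HatSD0 →ₗ[ℂ] Module.End ℂ V) (𝒱 : ℤ → Submodule ℂ V) (v : V)
    (hV : SuperCircle.HatSD0.IsIrreducibleHighestWeight ξ ρ 𝒱 v) :
    SuperCircle.HatSD0.IsQuasifinite 𝒱 ↔
      ∃ α : Polynomial ℂ, α ≠ 0 ∧
        SuperCircle.HatSD0.diffOp α
          (SuperCircle.HatSD0.Delta₀ ξ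
            + SuperCircle.HatSD0.Delta₁ ξ * SuperCircle.HatSD0.expHalf
            - PowerSeries.C (ξ SuperCircle.HatSD0.central / 2)) = 0 := by
  simp only [SuperCircle.HatSD0.diffOp_eq_zero_iff]
  exact hV.isQuasifinite_iff_exists
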